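/- Let $\mathcal S$ be the category of spaces (= simplicial sets), let $\Delta$ be the category of the finite nonempty ordinals $[q]=\{0<\dots<q\}$, and for $0\le n<\infty$ let $\Delta^{<n+1}\subset\Delta$ be the full subcategory on the $[q]$ with $q<n+1$; put $\Delta^{<\infty+1}=\Delta$. For a small category $D$ and functors $A,B\colon D\to\mathcal S$, let $\hom(A,B)$ be the mapping space with $k$-simplices the natural transformations $A\times\Delta[k]\to B$. Let $\operatorname{holim}_D X=\hom(N(D/ -),X)$ be the Bousfield–Kan homotopy limit, where the $m$-simplices of the nerve $N(C)$ of a category $C$ are the chains $c_0\leftarrow c_1\leftarrow\dots\leftarrow c_m$; for a functor $Z^\bullet$ on $\Delta$ write $\operatorname{holim}_{\Delta^{<n+1}}Z^\bullet$ for the homotopy limit of its restriction. A cosimplicial space $Z^\bullet\colon\Delta\to\mathcal S$ is fibrant if for every $n\ge0$ the matching map $Z^n\to M^nZ^\bullet=\lim_{[n]\twoheadrightarrow[p],\,p<n}Z^p$ is a Kan fibration. Let $\operatorname{Tot}_nZ^\bullet=\hom(\operatorname{sk}_n\Delta,Z^\bullet)$, where $\operatorname{sk}_n\Delta$ is the cosimplicial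 space $[q]\mapsto\operatorname{sk}_n\Delta[q]$, and $\operatorname{Tot}_\infty Z^\bullet=\operatorname{Tot}Z^\bullet=\hom(\Delta,Z^\bullet)$. For $0\le n\le\infty$, restriction along $\Delta^{<n+1}\subset\Delta$ followed by precomposition with the zeroth vertex map $$z\colon N(\Delta^{<n+1}/[q])\to\Delta[q]=\operatorname{sk}_n\Delta[q]\quad([q]\in\Delta^{<n+1}),\qquad (\alpha\colon[p]\to[q])\mapsto\alpha(0),$$ is a map $z^*\colon\operatorname{Tot}_nZ^\bullet\to\operatorname{holim}_{\Delta^{<n+1}}Z^\bullet$; for $n=\infty$ it is the Bousfield–Kan map $\operatorname{Tot}Z^\bullet\to\operatorname{holim}_\Delta Z^\bullet$. **Proposition.** For every fibrant cosimplicial space $Z^\bullet$ and every $0\le n\le\infty$, the map $$z^*\colon\operatorname{Tot}_nZ^\bullet\xrightarrow{\ \simeq\ }\operatorname{holim}_{\Delta^{<n+1}}Z^\bullet$$ is a weak equivalence. These maps are natural in $Z^\bullet$, and they are compatible for varying $n$: for $0\le n\le m\le\infty$ the composites $\operatorname{Tot}_mZ^\bullet\to\operatorname{Tot}_nZ^\bullet\xrightarrow{z^*}\operatorname{holim}_{\Delta^{<n+1}}Z^\bullet$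 and $\operatorname{Tot}_mZ^\bullet\xrightarrow{z^*}\operatorname{holim}_{\Delta^{<m+1}}Z^\bullet\to\operatorname{holim}_{\Delta^{<n+1}}Z^\bullet$ agree, the unnamed maps being induced by $\operatorname{sk}_n\Delta\subset\operatorname{sk}_m\Delta$ (with $\operatorname{sk}_\infty\Delta=\Delta$) and $\Delta^{<n+1}\subset\Delta^{<m+1}$. -/

import Mathlib

open CategoryTheory MonoidalCategory Opposite Simplicial HomotopicalAlgebra
open scoped SSet.modelCategoryQuillen

universe u

noncomputable section

namespace CosimplicialSpace

/-! ### Weak equivalences of spaces (= simplicial sets) -/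

/-- A map of simplicial sets `f : X ⟶ Y` is a weak (homotopy) equivalence if for every Kan
complex `K` the map `f^* : π₀ hom(Y, K) → π₀ hom(X, K)`, i.e. `[Y, K] → [X, K]`,
is a bijection. -/
def IsWeakEquivalence {X Y : SSet.{u}} (f : X ⟶ Y) : Prop :=
  ∀ (K : SSet.{u}), SSet.KanComplex K →
    Function.Bijective (SSet.mapπ₀ ((MonoidalClosed.pre f).app K))

/-! ### Diagrams of spaces: mapping spaces and homotopy limits -/

section Diagrams

variable {D : Type} [SmallCategory D] {E : Type} [SmallCategory E]

/-- The mapping space `hom(A, B)` of two diagrams of spaces `A, B : D ⥤ SSet`: its `k`-simplices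
are the natural transformations `A × Δ[k] ⟶ B`. -/
def mapSpace (A B : D ⥤ SSet.{u}) : SSet.{u} where
  obj k := (A ⋙ tensorRight (SSet.stdSimplex.obj k.unop)) ⟶ B
  map θ := ↾fun φ ↦
    Functor.whiskerLeft A ((tensoringRight SSet.{u}).map (SSet.stdSimplex.map θ.unop)) ≫ φ
  map_id k := by
    refine ConcreteCategory.hom_ext _ _ fun φ ↦ ?_
    have h : SSet.stdSimplex.{u}.map (𝟙 k.unop) = 𝟙 _ := CategoryTheory.Functor.map_id _ _
    change Functor.whiskerLeft A ((tensoringRight SSet.{u}).map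
      (SSet.stdSimplex.map (𝟙 k.unop))) ≫ φ = φ
    rw [h, CategoryTheory.Functor.map_id]
    exact Category.id_comp φ
  map_comp θ θ' := by
    refine ConcreteCategory.hom_ext _ _ fun φ ↦ ?_
    have h : SSet.stdSimplex.{u}.map (θ'.unop ≫ θ.unop) =
      SSet.stdSimplex.map θ'.unop ≫ SSet.stdSimplex.map θ.unop :=
        CategoryTheory.Functor.map_comp _ _ _
    change Functor.whiskerLeft A ((tensoringRight SSet.{u}).map
      (SSet.stdSimplex.map (θ'.unop ≫ θ.unop))) ≫ φ = _
    rw [h, CategoryTheory.Functor.map_comp, Functor.whiskerLeft_comp, Category.assoc]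
    rfl

/-- Precomposition with `a : A' ⟶ A`, as a map of mapping spaces. -/
def mapSpacePre {A A' : D ⥤ SSet.{u}} (a : A' ⟶ A) (B : D ⥤ SSet.{u}) :
    mapSpace A B ⟶ mapSpace A' B where
  app k := ↾fun φ ↦ Functor.whiskerRight a (tensorRight (SSet.stdSimplex.obj k.unop)) ≫ φ
  naturality k l θ := by
    refine ConcreteCategory.hom_ext _ _ fun φ ↦ ?_
    apply NatTrans.ext
    funext d
    change a.app d ▷ _ ≫ _ ◁ SSet.stdSimplex.map θ.unop ≫ φ.app d =
      _ ◁ SSet.stdSimplex.map θ.unop ≫ a.app d ▷ _ ≫ φ.app d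
    rw [whisker_exchange_assoc]

/-- Postcomposition with `b : B ⟶ B'`, as a map of mapping spaces. -/
def mapSpacePost (A : D ⥤ SSet.{u}) {B B' : D ⥤ SSet.{u}} (b : B ⟶ B') :
    mapSpace A B ⟶ mapSpace A B' where
  app k := ↾fun φ ↦ φ ≫ b
  naturality k l θ := by
    refine ConcreteCategory.hom_ext _ _ fun φ ↦ ?_
    exact Category.assoc (Functor.whiskerLeft A ((tensoringRight SSet.{u}).map
      (SSet.stdSimplex.map θ.unop))) φ b

/-- Restriction of mapping spaces along a functor `F : E ⥤ D`. -/
def mapSpaceRestrict (F : E ⥤ D) (A B : D ⥤ SSet.{u}) :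
    mapSpace A B ⟶ mapSpace (F ⋙ A) (F ⋙ B) where
  app _ := ↾fun φ ↦ Functor.whiskerLeft F φ
  naturality _ _ _ := rfl

variable (D) in
/-- The diagram of spaces `N(D/•) : D ⥤ SSet`. Here `N` is the nerve (underlying space) with the
Bousfield--Kan orientation: the `m`-simplices of `N(C)` are the chains `c₀ ← c₁ ← ⋯ ← cₘ` in `C`,
so `N(C)` is the nerve of `Cᵒᵖ` in the orientation of Mathlib. -/
def overNerve : D ⥤ SSet.{u} :=
  Over.mapFunctor D ⋙ Cat.opFunctor ⋙ nerveFunctor ⋙ SSet.uliftFunctor.{u, 0}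

lemma over_map_comp_post (F : E ⥤ D) {e e' : E} (f : e ⟶ e') :
    Over.map f ⋙ Over.post F = Over.post F ⋙ Over.map (F.map f) := by
  refine CategoryTheory.Functor.ext (fun α ↦ ?_) (fun α β h ↦ ?_)
  · change Over.mk (F.map (α.hom ≫ f)) = Over.mk (F.map α.hom ≫ F.map f)
    rw [F.map_comp]
  · ext
    simp only [Over.comp_left, Over.eqToHom_left]
    change F.map h.left = eqToHom rfl ≫ F.map h.left ≫ eqToHom rfl
    simp

/-- The map of diagrams `N(E/•) ⟶ N(D/F(•))` induced by a functor `F : E ⥤ D`. -/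
def overNerveMap (F : E ⥤ D) : overNerve.{u} E ⟶ F ⋙ overNerve.{u} D where
  app e := SSet.uliftFunctor.{u, 0}.map (nerveMap (Over.post (X := e) F).op)
  naturality e e' f := by
    change SSet.uliftFunctor.{u, 0}.map (nerveMap (Over.map f ⋙ Over.post F).op) =
      SSet.uliftFunctor.{u, 0}.map (nerveMap (Over.post F ⋙ Over.map (F.map f)).op)
    rw [over_map_comp_post]

/-- The Bousfield--Kan homotopy limit `holim_D X = hom(N(D/•), X)`. -/
def holim (X : D ⥤ SSet.{u}) : SSet.{u} := mapSpace (overNerve D) X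

/-- The map `holim_D X ⟶ holim_D Y` induced by a map of diagrams. -/
def holimMap {X Y : D ⥤ SSet.{u}} (f : X ⟶ Y) : holim X ⟶ holim Y :=
  mapSpacePost (overNerve D) f

/-- The canonical map `holim_D X ⟶ holim_E (X ∘ F)` induced by a functor `F : E ⥤ D`. -/
def holimRestrict (F : E ⥤ D) (X : D ⥤ SSet.{u}) : holim X ⟶ holim (F ⋙ X) :=
  mapSpaceRestrict F (overNerve D) X ≫ mapSpacePre (overNerveMap F) (F ⋙ X)

/-- For `i : D ⥤ Δ`, the zeroth vertex map `z : N(D/d) ⟶ Δ[i d]`, sending a vertex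
`α : d' ⟶ d` of `N(D/d)` to the vertex `i(α)(0)` of `Δ[i d]`. -/
def zerothVertex (i : D ⥤ SimplexCategory) : overNerve.{u} D ⟶ i ⋙ SSet.stdSimplex.{u} where
  app d :=
    { app := fun k ↦ ↾fun c ↦ SSet.stdSimplex.objMk
        { toFun := fun j ↦ (i.map (c.down.obj j).unop.hom).toOrderHom 0
          monotone' := fun j j' h ↦ by
            have hw := Over.w (c.down.map (homOfLE h)).unop
            change (i.map (c.down.obj j).unop.hom).toOrderHom 0 ≤
              (i.map (c.down.obj j').unop.hom).toOrderHom 0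
            rw [← hw, i.map_comp]
            exact (i.map (c.down.obj j).unop.hom).toOrderHom.monotone (Fin.zero_le _) }
      naturality := fun k l θ ↦ by
        rfl }
  naturality d d' f := by
    apply NatTrans.ext
    funext k
    refine ConcreteCategory.hom_ext _ _ fun c ↦ ?_
    apply SSet.stdSimplex.objEquiv.injective
    apply SimplexCategory.Hom.ext
    apply OrderHom.ext
    funext j
    change (i.map ((c.down.obj j).unop.hom ≫ f)).toOrderHom 0 =
      (i.map f).toOrderHom ((i.map (c.down.obj j).unop.hom).toOrderHom 0)
    rw [i.map_comp]
    rfl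

end Diagrams

/-! ### Cosimplicial spaces: fibrancy, `Tot` and `Tot_n` -/

/-- The (Reedy) matching space `M^n Z` of a cosimplicial space `Z` at `[n]`: the limit of the
spaces `Z^p` over all surjections `σ : [n] ⟶ [p]` with `p < n`. -/
def matchingSpace (Z : SimplexCategory ⥤ SSet.{u}) (n : SimplexCategory) : SSet.{u} where
  obj k := { x : ∀ (p : SimplexCategory) (σ : n ⟶ p), Epi σ → p.len < n.len → (Z.obj p).obj k //
    ∀ (p q : SimplexCategory) (σ : n ⟶ p) (τ : p ⟶ q) (hσ : Epi σ) (hp : p.len < n.len)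
      (hστ : Epi (σ ≫ τ)) (hq : q.len < n.len),
      (Z.map τ).app k (x p σ hσ hp) = x q (σ ≫ τ) hστ hq }
  map θ := ↾fun x ↦ ⟨fun p σ hσ hp ↦ (Z.obj p).map θ (x.1 p σ hσ hp),
    fun p q σ τ hσ hp hστ hq ↦ by
      rw [NatTrans.naturality_apply, x.2 p q σ τ hσ hp hστ hq]⟩
  map_id k := by
    refine ConcreteCategory.hom_ext _ _ fun x ↦ ?_
    apply Subtype.ext
    funext p σ hσ hp
    simp
  map_comp θ θ' := by
    refine ConcreteCategory.hom_ext _ _ fun x ↦ ?_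
    apply Subtype.ext
    funext p σ hσ hp
    simp

/-- The matching map `Z^n ⟶ M^n Z`, with components the codegeneracies `Z(σ)`. -/
def matchingMap (Z : SimplexCategory ⥤ SSet.{u}) (n : SimplexCategory) :
    Z.obj n ⟶ matchingSpace Z n where
  app k := ↾fun z ↦ ⟨fun p σ _ _ ↦ (Z.map σ).app k z, fun p q σ τ _ _ _ _ ↦ by simp⟩
  naturality k l θ := by
    refine ConcreteCategory.hom_ext _ _ fun z ↦ ?_
    apply Subtype.ext
    funext p σ hσ hp
    exact NatTrans.naturality_apply (Z.map σ) θ z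

/-- A cosimplicial space is fibrant if all its matching maps are Kan fibrations (for `n = 0` this
says that `Z^0` is a Kan complex). -/
def IsFibrantCosimplicial (Z : SimplexCategory ⥤ SSet.{u}) : Prop :=
  ∀ n : SimplexCategory, Fibration (matchingMap Z n)

lemma skeleton_le_preimage {X Y : SSet.{u}} (f : X ⟶ Y) (n : ℕ) :
    X.skeleton n ≤ (Y.skeleton n).preimage f := by
  change (⨆ (i : Fin n) (x : X.nonDegenerate i), SSet.Subcomplex.ofSimplex x.1) ≤ _
  refine iSup_le fun i ↦ iSup_le fun x ↦ ?_
  rw [SSet.Subcomplex.ofSimplex_le_iff]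
  exact Y.mem_skeleton _ i.isLt

/-- The cosimplicial space `sk_n Δ`, with `sk_n Δ[q] ⊆ Δ[q]` the subspace generated by the
simplices of dimension at most `n`. (In Mathlib, `X.skeleton m` is generated by the simplices of
dimension `< m`.) -/
def skDelta (n : ℕ) : SimplexCategory ⥤ SSet.{u} where
  obj q := ((SSet.stdSimplex.{u}.obj q).skeleton (n + 1) : SSet.{u})
  map {q r} θ := SSet.Subcomplex.lift
    (((SSet.stdSimplex.{u}.obj q).skeleton (n + 1)).ι ≫ SSet.stdSimplex.map θ) (by
      rintro m _ ⟨⟨x, hx⟩, rfl⟩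
      exact skeleton_le_preimage (SSet.stdSimplex.map θ) (n + 1) m hx)
  map_id q := by
    rw [← cancel_mono (SSet.Subcomplex.ι _)]
    have h : SSet.stdSimplex.{u}.map (𝟙 q) = 𝟙 _ := CategoryTheory.Functor.map_id _ _
    change SSet.Subcomplex.ι _ ≫ SSet.stdSimplex.map (𝟙 q) = SSet.Subcomplex.ι _
    rw [h, Category.comp_id]
  map_comp {q r t} θ θ' := by
    rw [← cancel_mono (SSet.Subcomplex.ι _)]
    have h : SSet.stdSimplex.{u}.map (θ ≫ θ') =
      SSet.stdSimplex.map θ ≫ SSet.stdSimplex.map θ' := CategoryTheory.Functor.map_comp _ _ _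
    change SSet.Subcomplex.ι _ ≫ SSet.stdSimplex.map (θ ≫ θ') =
      SSet.Subcomplex.ι _ ≫ SSet.stdSimplex.map θ ≫ SSet.stdSimplex.map θ'
    rw [h]

/-- The inclusion `sk_n Δ ⟶ sk_m Δ` for `n ≤ m`. -/
def skDeltaIncl {n m : ℕ} (h : n ≤ m) : skDelta.{u} n ⟶ skDelta.{u} m where
  app q := SSet.Subcomplex.homOfLE
    ((SSet.stdSimplex.{u}.obj q).skeleton.monotone (Nat.succ_le_succ h))
  naturality _ _ _ := rfl

/-- The inclusion `sk_n Δ ⟶ Δ`. -/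
def skDeltaι (n : ℕ) : skDelta.{u} n ⟶ SSet.stdSimplex.{u} where
  app q := ((SSet.stdSimplex.{u}.obj q).skeleton (n + 1)).ι
  naturality _ _ _ := rfl

/-- `Tot Z = hom(Δ, Z)`. -/
def Tot (Z : SimplexCategory ⥤ SSet.{u}) : SSet.{u} := mapSpace SSet.stdSimplex.{u} Z

/-- `Tot_n Z = hom(sk_n Δ, Z)`. -/
def TotN (n : ℕ) (Z : SimplexCategory ⥤ SSet.{u}) : SSet.{u} := mapSpace (skDelta.{u} n) Z

/-- The map `Tot Z ⟶ Tot W` induced by `f : Z ⟶ W`. -/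
def totMap {Z W : SimplexCategory ⥤ SSet.{u}} (f : Z ⟶ W) : Tot Z ⟶ Tot W :=
  mapSpacePost SSet.stdSimplex.{u} f

/-- The map `Tot_n Z ⟶ Tot_n W` induced by `f : Z ⟶ W`. -/
def totNMap (n : ℕ) {Z W : SimplexCategory ⥤ SSet.{u}} (f : Z ⟶ W) : TotN n Z ⟶ TotN n W :=
  mapSpacePost (skDelta.{u} n) f

/-- The tower map `Tot_m Z ⟶ Tot_n Z` for `n ≤ m`, induced by `sk_n Δ ⊆ sk_m Δ`. -/
def totNRestrict {n m : ℕ} (h : n ≤ m) (Z : SimplexCategory ⥤ SSet.{u}) : TotN m Z ⟶ TotN n Z :=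
  mapSpacePre (skDeltaIncl h) Z

/-- The map `Tot Z ⟶ Tot_n Z` induced by `sk_n Δ ⊆ Δ`. -/
def totRestrict (n : ℕ) (Z : SimplexCategory ⥤ SSet.{u}) : Tot Z ⟶ TotN n Z :=
  mapSpacePre (skDeltaι n) Z

/-! ### Homotopy limits over `Δ` and `Δ^{<n+1}`

The category `Δ^{<n+1}`, the full subcategory of `Δ` on the `[q]` with `q < n + 1`, is
`SimplexCategory.Truncated n`, with inclusion `SimplexCategory.Truncated.inclusion n` into `Δ`. -/

/-- `holim_{Δ^{<n+1}} Z`, the homotopy limit of the restriction of `Z` to `Δ^{<n+1}`. -/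
def holimN (n : ℕ) (Z : SimplexCategory ⥤ SSet.{u}) : SSet.{u} :=
  holim (SimplexCategory.Truncated.inclusion n ⋙ Z)

/-- The map `holim_{Δ^{<n+1}} Z ⟶ holim_{Δ^{<n+1}} W` induced by `f : Z ⟶ W`. -/
def holimNMap (n : ℕ) {Z W : SimplexCategory ⥤ SSet.{u}} (f : Z ⟶ W) :
    holimN n Z ⟶ holimN n W :=
  holimMap (Functor.whiskerLeft (SimplexCategory.Truncated.inclusion n) f)

/-- The canonical map `holim_{Δ^{<m+1}} Z ⟶ holim_{Δ^{<n+1}} Z` for `n ≤ m`. -/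
def holimNRestrict {n m : ℕ} (h : n ≤ m) (Z : SimplexCategory ⥤ SSet.{u}) :
    holimN m Z ⟶ holimN n Z :=
  holimRestrict (SimplexCategory.Truncated.incl n m h)
    (SimplexCategory.Truncated.inclusion m ⋙ Z)

/-- The canonical map `holim_Δ Z ⟶ holim_{Δ^{<n+1}} Z`. -/
def holimNOfHolim (n : ℕ) (Z : SimplexCategory ⥤ SSet.{u}) : holim Z ⟶ holimN n Z :=
  holimRestrict (SimplexCategory.Truncated.inclusion n) Z

/-! ### The comparison maps `z^*` -/

lemma mem_skeleton_stdSimplex {q : SimplexCategory} {n : ℕ} (h : q.len < n)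
    {k : SimplexCategoryᵒᵖ} (x : (SSet.stdSimplex.{u}.obj q).obj k) :
    x ∈ ((SSet.stdSimplex.{u}.obj q).skeleton n).obj k := by
  have hx : (SSet.stdSimplex.{u}.obj q).map (SSet.stdSimplex.objEquiv x).op
      (SSet.stdSimplex.objEquiv.symm (𝟙 q)) = x :=
    SSet.stdSimplex.objEquiv.injective (Category.comp_id (SSet.stdSimplex.objEquiv x))
  rw [← hx]
  exact ((SSet.stdSimplex.{u}.obj q).skeleton n).map (SSet.stdSimplex.objEquiv x).op
    ((SSet.stdSimplex.{u}.obj q).mem_skeleton (SSet.stdSimplex.objEquiv.symm (𝟙 q)) h)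

/-- The zeroth vertex map `N(Δ^{<n+1}/[q]) ⟶ Δ[q] = sk_n Δ[q]`, for `[q]` in `Δ^{<n+1}`. -/
def zerothVertexN (n : ℕ) :
    overNerve.{u} (SimplexCategory.Truncated n) ⟶
      SimplexCategory.Truncated.inclusion n ⋙ skDelta.{u} n where
  app q := SSet.Subcomplex.lift
    ((zerothVertex (SimplexCategory.Truncated.inclusion n)).app q) (by
      rintro k _ ⟨c, rfl⟩
      exact mem_skeleton_stdSimplex (Nat.lt_succ_of_le q.property) _)
  naturality q r θ := by
    apply (cancel_mono ((SSet.stdSimplex.{u}.obj r.obj).skeleton (n + 1)).ι).1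
    exact (zerothVertex (SimplexCategory.Truncated.inclusion n)).naturality θ

/-- The Bousfield--Kan map `z^* : Tot Z = hom(Δ, Z) ⟶ hom(N(Δ/•), Z) = holim_Δ Z` induced by the
zeroth vertex map. -/
def totToHolim (Z : SimplexCategory ⥤ SSet.{u}) : Tot Z ⟶ holim Z :=
  mapSpacePre (zerothVertex (𝟭 SimplexCategory)) Z

/-- The map `z^* : Tot_n Z ⟶ holim_{Δ^{<n+1}} Z`: restrict along `i : Δ^{<n+1} ⥤ Δ`,
`hom(sk_n Δ, Z) ⟶ hom(i^* sk_n Δ, i^* Z) = hom(i^* Δ, i^* Z)`, and precompose with the zeroth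
vertex map `N(Δ^{<n+1}/•) ⟶ i^* Δ`. -/
def totNToHolimN (n : ℕ) (Z : SimplexCategory ⥤ SSet.{u}) : TotN n Z ⟶ holimN n Z :=
  mapSpaceRestrict (SimplexCategory.Truncated.inclusion n) (skDelta.{u} n) Z ≫
    mapSpacePre (zerothVertexN n) (SimplexCategory.Truncated.inclusion n ⋙ Z)

end CosimplicialSpace

end

noncomputable section

namespace CosimplicialSpace

/-! ### Nondegenerate simplices of the nerve of a category -/

section Nerve

variable {E : Type u} [Category.{u} E]

/-! The zeroth vertex map is not a cofibration of diagrams, so it is replaced by a mapping cylinder.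
For `i : D ⥤ Δ` (the identity, or the inclusion of `Δ^{<n+1}`), glue `(D/d)ᵒᵖ` and the poset `[i d]`
into one category `Collage i d`, with a unique morphism from `α` to the vertex `k` when `α(0) ≤ k`
and none back. Its nerve contains `N(D/d)` and `Δ[i d]`, and `α ↦ α(0)` retracts it onto the
simplex. Hence `z` is the inclusion `overNerveToCollage` followed by the retraction
`collageToStdSimplex`.

The morphisms `α ⟶ α(0)` make the retraction a deformation retraction, naturally in `d`, so it
induces a homotopy equivalence of mapping spaces. The inclusion is a Reedy trivial cofibration: its
relative latching maps are anodyne. Mapping it into a fibrant `Z` therefore gives a map with the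
right lifting property against all monomorphisms: a lifting problem is a partially defined natural
transformation, which `exists_extension` extends degree by degree by lifting against the matching
maps.

The combinatorial heart is `anodyneExtensions_latching_ι`. A chain outside the relative latching
subcomplex consists of arrows over `d` followed by at least one vertex, and the image of its first
object together with its vertices fills `[i d]`. Call an arrow a flag if it is mono and its image
contains all vertices of the chain. Just before the first object that is not a flag, insert (or
delete, if it is already there) the mono whose image is the union of the image of that object with
the vertices of the chain. This is possible and unambiguous because a morphism of the collage out of
a mono is unique, and exists as soon as the images are nested. The nondegenerate simplices are
thereby matched in a regular pairing.

For finite `n`, `sk_n Δ` is left Kan extended from `Δ^{<n+1}` and coincides there with `Δ`; hence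
restriction of mapping spaces is an isomorphism (`isIso_mapSpaceRestrict`) and the argument above
applies to `D = Δ^{<n+1}`. -/

/-- The morphism of the chain `x` from position `a` to position `b` is an identity. -/
def IsIdOn {n : ℕ} (x : ComposableArrows E n) (a b : Fin (n + 1)) (h : a ≤ b) : Prop :=
  ∃ e : x.obj a = x.obj b, x.map (homOfLE h) = eqToHom e

lemma composableArrows_ext {n : ℕ} {x y : ComposableArrows E n} (h : ∀ a, x.obj a = y.obj a)
    (w : ∀ i : Fin n, x.map (homOfLE i.castSucc_le_succ) =
      eqToHom (h _) ≫ y.map (homOfLE i.castSucc_le_succ) ≫ eqToHom (h _).symm) : x = y :=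
  ComposableArrows.ext h (fun i hi ↦ w ⟨i, hi⟩)

lemma isIdOn_of_eq {n : ℕ} (x : ComposableArrows E n) {a b : Fin (n + 1)} (h : a = b) :
    IsIdOn x a b h.le := by
  subst h
  exact ⟨rfl, x.map_id a⟩

/-- The morphisms from position `a` to position `φ a` form a natural transformation whose components
are identities, so both chains coincide. -/
lemma functor_comp_eq_of_isIdOn {n : ℕ} (x : ComposableArrows E n) (φ : Fin (n + 1) → Fin (n + 1))
    (hφ : Monotone φ) (hle : ∀ a, a ≤ φ a) (hid : ∀ a, IsIdOn x a (φ a) (hle a)) :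
    (hφ.functor ⋙ x : ComposableArrows E n) = x := by
  have hid' : ∀ a, ∃ e : x.obj a = x.obj (φ a), x.map (homOfLE (hle a)) = eqToHom e := hid
  choose e he using hid'
  refine (composableArrows_ext e fun k ↦ ?_).symm
  have h2 : eqToHom (e k.succ).symm ≫ x.map (homOfLE (hle k.succ)) = 𝟙 _ := by
    rw [he]
    simp
  have : IsIso (x.map (homOfLE (hle k.succ))) := by
    rw [he]
    infer_instance
  change _ = eqToHom (e k.castSucc) ≫ x.map (homOfLE (hφ k.castSucc_le_succ)) ≫
    eqToHom (e k.succ).symm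
  rw [← he, ← cancel_mono (x.map (homOfLE (hle k.succ))), Category.assoc, Category.assoc, h2,
    ← x.map_comp, Category.comp_id, ← x.map_comp]
  rfl

lemma mem_range_nerve_σ_iff {n : ℕ} (x : (nerve E) _⦋n + 1⦌) (i : Fin (n + 1)) :
    x ∈ Set.range ((nerve E).σ i) ↔ IsIdOn x i.castSucc i.succ i.castSucc_le_succ := by
  constructor
  · rintro ⟨y, rfl⟩
    exact isIdOn_of_eq (E := E) (n := n) y (a := i.predAbove i.castSucc)
      (b := i.predAbove i.succ) (by simp)
  · intro h
    -- This collapses `i` and `i + 1` and then skips `i`: it fixes every position except `i`, which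
    -- goes to `i + 1`. So `x` is the degeneracy of its own face opposite `i`.
    let φ : Fin (n + 2) → Fin (n + 2) := fun a ↦ i.castSucc.succAbove (i.predAbove a)
    have hφ (a : Fin (n + 2)) : (a ≠ i.castSucc ∧ φ a = a) ∨ (a = i.castSucc ∧ φ a = i.succ) := by
      obtain ha | rfl | ha := lt_trichotomy a i.castSucc
      · refine Or.inl ⟨ha.ne, ?_⟩
        simp only [φ]
        rw [Fin.predAbove_of_le_castSucc _ _ ha.le, Fin.succAbove_of_castSucc_lt _ _ (by simpa)]
        simp
      · simp [φ]
      · refine Or.inl ⟨ha.ne', ?_⟩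
        simp only [φ]
        rw [Fin.predAbove_of_castSucc_lt _ _ ha, Fin.succAbove_of_le_castSucc]
        · simp
        · rw [Fin.lt_def] at ha
          rw [Fin.le_def]
          simp at ha ⊢
          omega
    have hle (a : Fin (n + 2)) : a ≤ φ a := by
      obtain ⟨_, h⟩ | ⟨rfl, h⟩ := hφ a <;> rw [h]
      exact i.castSucc_le_succ
    have hid (a : Fin (n + 2)) : IsIdOn x a (φ a) (hle a) := by
      obtain ⟨_, h'⟩ | ⟨rfl, h'⟩ := hφ a
      · exact isIdOn_of_eq _ h'.symm
      · generalize_proofs h₁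
        revert h₁
        rw [h']
        exact fun _ ↦ h
    have hmono : Monotone φ :=
      (Fin.strictMono_succAbove _).monotone.comp (Fin.predAbove_right_monotone _)
    exact ⟨(nerve E).δ i.castSucc x, functor_comp_eq_of_isIdOn (E := E) (n := n + 1) x φ hmono hle hid⟩

lemma mem_nerve_nonDegenerate_iff {n : ℕ} (x : (nerve E) _⦋n⦌) :
    x ∈ (nerve E).nonDegenerate n ↔
      ∀ (a b : Fin (n + 1)) (h : a.val + 1 = b.val), ¬ IsIdOn x a b (Fin.le_def.2 (by omega)) := by
  obtain _ | n := n
  · simp only [SSet.nondegenerate_zero, Set.mem_univ, true_iff]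
    intro a b h
    omega
  · rw [SSet.mem_nonDegenerate_iff_notMem_degenerate, SSet.degenerate_eq_iUnion_range_σ,
      Set.mem_iUnion]
    simp only [mem_range_nerve_σ_iff, not_exists]
    constructor
    · intro h a b hab
      have hb : b.val < n + 2 := b.isLt
      obtain ⟨i, rfl⟩ : ∃ i : Fin (n + 1), a = i.castSucc := ⟨⟨a.val, by omega⟩, rfl⟩
      obtain rfl : b = i.succ := Fin.ext hab.symm
      exact h _
    · intro h i
      exact h _ _ rfl

end Nerve

/-! ### Categories with images -/

/-- A category `E` with a notion of image of its objects in a set `V`. -/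
structure ImageStructure (E : Type u) [Category.{u} E] (V : Type) where
  /-- the image of an object -/
  im : E → Set V
  /-- the objects which are considered as points -/
  IsPt : E → Prop
  /-- the objects which are considered as subobjects -/
  IsSub : E → Prop
  im_subset {X Y : E} (f : X ⟶ Y) (hY : ¬ IsPt Y) : im Y ⊆ im X
  subsingleton_hom {X : E} (hX : IsSub X) (Y : E) : Subsingleton (X ⟶ Y)
  nonempty_hom {X : E} (hX : IsSub X) (Y : E) (h : im Y ⊆ im X) : Nonempty (X ⟶ Y)
  ext {X Y : E} (hX : IsSub X) (hY : IsSub Y) (h : im X = im Y) : X = Y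
  exists_sub (Y : E) (T : Set V) (h : im Y ⊆ T) : ∃ X, IsSub X ∧ im X = T
  not_isPt {X : E} (hX : IsSub X) : ¬ IsPt X

namespace ImageStructure

variable {E : Type u} [Category.{u} E] {V : Type} (S : ImageStructure E V)

/-- The set of the points of a chain. -/
def ptSet {n : ℕ} (x : ComposableArrows E n) : Set V :=
  { k | ∃ a, S.IsPt (x.obj a) ∧ k ∈ S.im (x.obj a) }

/-- The support of the part of a chain which starts at the position `a`. -/
def supp {n : ℕ} (x : ComposableArrows E n) (a : Fin (n + 1)) : Set V :=
  S.im (x.obj a) ∪ S.ptSet x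

/-- The object of the chain `x` at the position `a` is a subobject containing all points of `x`. -/
def IsFlag {n : ℕ} (x : ComposableArrows E n) (a : Fin (n + 1)) : Prop :=
  S.IsSub (x.obj a) ∧ S.ptSet x ⊆ S.im (x.obj a)

/-- The image of a point need not lie in the earlier images; adding all points of the chain to every
support is what makes the supports decrease. -/
lemma supp_subset {n : ℕ} (x : ComposableArrows E n) {a b : Fin (n + 1)} (h : a ≤ b) :
    S.supp x b ⊆ S.supp x a := by
  refine Set.union_subset ?_ Set.subset_union_right
  by_cases hb : S.IsPt (x.obj b)
  · exact fun k hk ↦ Or.inr ⟨b, hb, hk⟩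
  · exact (S.im_subset (x.map (homOfLE h)) hb).trans Set.subset_union_left

variable {S} in
lemma IsFlag.supp_eq {n : ℕ} {x : ComposableArrows E n} {a : Fin (n + 1)} (h : S.IsFlag x a) :
    S.supp x a = S.im (x.obj a) :=
  Set.union_eq_left.2 h.2

lemma ptSet_comp_subset {n m : ℕ} (x : ComposableArrows E n) (F : Fin (m + 1) ⥤ Fin (n + 1)) :
    S.ptSet (F ⋙ x : ComposableArrows E m) ⊆ S.ptSet x := by
  rintro k ⟨a, ha⟩
  exact ⟨F.obj a, ha⟩

/-- The chains with no point or whose support is not everything. -/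
def latching : (nerve E).Subcomplex where
  obj n := { x | S.ptSet (n := n.unop.len) x = ∅ ∨ S.supp (n := n.unop.len) x 0 ≠ Set.univ }
  map {n m} f x hx := by
    have h := S.ptSet_comp_subset (n := n.unop.len) (m := m.unop.len) x
      (SimplexCategory.toCat.map f.unop).toFunctor
    obtain hx | hx := hx
    · left
      rw [hx] at h
      exact Set.subset_empty_iff.1 h
    · right
      intro h'
      refine hx (Set.eq_univ_of_univ_subset ?_)
      rw [← h']
      refine Set.union_subset ?_ (h.trans Set.subset_union_right)
      exact Set.subset_union_left.trans
        (S.supp_subset (n := n.unop.len) x (Fin.zero_le (f.unop.toOrderHom 0)))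

lemma notMem_latching_iff {n : ℕ} (x : (nerve E) _⦋n⦌) :
    x ∉ S.latching.obj (op ⦋n⦌) ↔
      (S.ptSet (n := n) x).Nonempty ∧ S.supp (n := n) x 0 = Set.univ := by
  change ¬ (S.ptSet (n := n) x = ∅ ∨ S.supp (n := n) x 0 ≠ Set.univ) ↔ _
  rw [not_or, not_not, Set.nonempty_iff_ne_empty]

end ImageStructure

/-- A chain, as a simplex of the nerve. -/
def simplex {E : Type u} [Category.{u} E] {n : ℕ} (x : ComposableArrows E n) : (nerve E) _⦋n⦌ := x

/-- The face of a chain obtained by deleting the object at the position `i`. -/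
def face {E : Type u} [Category.{u} E] {n : ℕ} (i : Fin (n + 2)) (x : ComposableArrows E (n + 1)) :
    ComposableArrows E n := (nerve E).δ i x

/-! ### Deletion and insertion of a subobject in a chain -/

namespace ImageStructure

variable {E : Type u} [Category.{u} E] {V : Type} (S : ImageStructure E V)

lemma ptSet_face_subset {n : ℕ} (x : ComposableArrows E (n + 1)) (i : Fin (n + 2)) :
    S.ptSet (face i x) ⊆ S.ptSet x :=
  S.ptSet_comp_subset x _

lemma ptSet_face {n : ℕ} (x : ComposableArrows E (n + 1)) (i : Fin (n + 2))
    (hi : S.IsSub (x.obj i)) : S.ptSet (face i x) = S.ptSet x := by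
  refine (S.ptSet_face_subset x i).antisymm ?_
  rintro k ⟨a, ha⟩
  obtain ⟨b, rfl⟩ := Fin.exists_succAbove_eq (x := a) (y := i)
    (by rintro rfl; exact S.not_isPt hi ha.1)
  exact ⟨b, ha⟩

lemma isFlag_face_iff {n : ℕ} (x : ComposableArrows E (n + 1)) (i : Fin (n + 2))
    (hi : S.IsSub (x.obj i)) (a : Fin (n + 1)) :
    S.IsFlag (face i x) a ↔ S.IsFlag x (i.succAbove a) := by
  unfold IsFlag
  rw [S.ptSet_face x i hi]
  rfl

lemma supp_face {n : ℕ} (x : ComposableArrows E (n + 1)) (i : Fin (n + 2))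
    (hi : S.IsSub (x.obj i)) (a : Fin (n + 1)) :
    S.supp (face i x) a = S.supp x (i.succAbove a) := by
  unfold supp
  rw [S.ptSet_face x i hi]
  rfl

/-- `j` is the first position where the chain `x` is not a flag. -/
def IsFirst {n : ℕ} (x : ComposableArrows E n) (j : Fin (n + 1)) : Prop :=
  (∀ a < j, S.IsFlag x a) ∧ ¬ S.IsFlag x j

variable {S} in
lemma IsFirst.unique {n : ℕ} {x : ComposableArrows E n} {j k : Fin (n + 1)} (hj : S.IsFirst x j)
    (hk : S.IsFirst x k) : j = k := by
  by_contra h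
  obtain h | h := lt_or_gt_of_ne h
  · exact hj.2 (hk.1 _ h)
  · exact hk.2 (hj.1 _ h)

lemma exists_isFirst {n : ℕ} (x : ComposableArrows E n) (hx : (S.ptSet x).Nonempty) :
    ∃ j, S.IsFirst x j := by
  classical
  obtain ⟨k, a, ha, -⟩ := hx
  have h : ∃ a, ¬ S.IsFlag x a := ⟨a, fun h ↦ S.not_isPt h.1 ha⟩
  obtain ⟨j, hj, hj'⟩ := WellFounded.has_min (wellFounded_lt (α := Fin (n + 1)))
    { a | ¬ S.IsFlag x a } h
  exact ⟨j, fun a ha ↦ by_contra fun h' ↦ hj' a h' ha, hj⟩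

lemma eq_of_isFlag {n : ℕ} {x : ComposableArrows E n} {a b : Fin (n + 1)} (ha : S.IsFlag x a)
    (hb : S.IsFlag x b) (h : S.supp x a = S.supp x b) : x.obj a = x.obj b :=
  S.ext ha.1 hb.1 (by rw [← ha.supp_eq, ← hb.supp_eq, h])

lemma isIdOn_of_isSub {n : ℕ} {x : ComposableArrows E n} {a b : Fin (n + 1)} (h : a ≤ b)
    (ha : S.IsSub (x.obj a)) (e : x.obj a = x.obj b) : IsIdOn x a b h :=
  have := S.subsingleton_hom ha
  ⟨e, Subsingleton.elim _ _⟩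

/-- Chains agree if they have the same objects, and the same morphisms except
possibly for the ones starting from subobjects. -/
lemma chain_ext {n : ℕ} {x y : ComposableArrows E n} (h : ∀ a, x.obj a = y.obj a)
    (w : ∀ i : Fin n, S.IsSub (x.obj i.castSucc) ∨
      HEq (x.map (homOfLE i.castSucc_le_succ)) (y.map (homOfLE i.castSucc_le_succ))) : x = y := by
  refine composableArrows_ext h fun i ↦ ?_
  obtain hi | hi := w i
  · have := S.subsingleton_hom hi
    exact Subsingleton.elim _ _
  · exact (conj_eqToHom_iff_heq _ _ (h _) (h _)).2 hi

/-- Insertion of a subobject in a chain. -/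
lemma exists_face_eq {n : ℕ} (y : ComposableArrows E n) (j : Fin (n + 1)) (W : E)
    (hy : ∀ a < j, S.IsSub (y.obj a)) (hWj : Nonempty (W ⟶ y.obj j))
    (hW : ∀ a : Fin (n + 1), a.val + 1 = j.val → Nonempty (y.obj a ⟶ W)) :
    ∃ x : ComposableArrows E (n + 1), face j.castSucc x = y ∧ x.obj j.castSucc = W := by
  let o : Fin (n + 2) → E := Fin.insertNth (α := fun _ ↦ E) j.castSucc W y.obj
  have ho : o j.castSucc = W := Fin.insertNth_apply_same _ _ _
  have ho' (a : Fin (n + 1)) : o (j.castSucc.succAbove a) = y.obj a :=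
    Fin.insertNth_apply_succAbove _ _ _ _
  -- Only the morphisms starting at or after position `j` of `y` are recorded: the earlier ones
  -- start from subobjects and are forced, so `chain_ext` does not ask about them.
  have key (k : Fin (n + 1)) : ∃ g : o k.castSucc ⟶ o k.succ,
      ∀ a (ha : a.val + 1 = k.val), j ≤ a →
        HEq g (y.map (homOfLE (show a ≤ k from Fin.le_def.2 (by omega)))) := by
    obtain hk | rfl | hk := lt_trichotomy k j
    · have h1 : k.castSucc = j.castSucc.succAbove k := by
        rw [Fin.succAbove_of_castSucc_lt _ _ (by simpa)]
      obtain hk' | hk' := (show k.val + 1 ≤ j.val from hk).lt_or_eq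
      · have h2 : k.succ = j.castSucc.succAbove ⟨k.val + 1, by omega⟩ := by
          rw [Fin.succAbove_of_castSucc_lt _ _ (by simpa [Fin.lt_def])]
          rfl
        rw [h1, h2, ho', ho']
        exact ⟨y.map (homOfLE (Fin.le_def.2 (by simp))), fun a ha ha' ↦ by
          rw [Fin.le_def] at ha'; rw [Fin.lt_def] at hk; omega⟩
      · have h2 : k.succ = j.castSucc := Fin.ext hk'
        rw [h1, h2, ho, ho']
        exact ⟨(hW k hk').some, fun a ha ha' ↦ by
          rw [Fin.le_def] at ha'; rw [Fin.lt_def] at hk; omega⟩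
    · have h2 : k.succ = k.castSucc.succAbove k := by simp
      rw [ho, h2, ho']
      exact ⟨hWj.some, fun a ha ha' ↦ by rw [Fin.le_def] at ha'; omega⟩
    · have hk0 : j.val < k.val := hk
      have h1 : k.castSucc = j.castSucc.succAbove ⟨k.val - 1, by omega⟩ := by
        rw [Fin.succAbove_of_le_castSucc _ _ (by simp [Fin.le_def]; omega)]
        ext
        simp
        omega
      have h2 : k.succ = j.castSucc.succAbove k := by
        rw [Fin.succAbove_of_le_castSucc _ _ (by simpa using hk.le)]
      rw [h1, h2, ho', ho']
      refine ⟨y.map (homOfLE (Fin.le_def.2 (by simp))), fun a ha ha' ↦ ?_⟩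
      have h : (⟨k.val - 1, (Nat.sub_le _ _).trans_lt k.isLt⟩ : Fin (n + 1)) = a :=
        Fin.ext (by simp; omega)
      subst h
      rfl
  choose g hg using key
  let F : ComposableArrows E (n + 1) := ComposableArrows.mkOfObjOfMapSucc o g
  have hF (a b : Fin (n + 2)) (k : Fin (n + 1)) (ha : a = k.castSucc) (hb : b = k.succ)
      (h : a ≤ b) : HEq (F.map (homOfLE h)) (g k) := by
    subst ha hb
    exact heq_of_eq (ComposableArrows.mkOfObjOfMapSucc_map_succ o g k.val k.isLt)
  refine ⟨F, S.chain_ext ho' fun i ↦ ?_, ho⟩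
  obtain hi | hi := lt_or_ge i.castSucc j
  · left
    change S.IsSub (o (j.castSucc.succAbove i.castSucc))
    rw [ho']
    exact hy _ hi
  · right
    refine HEq.trans (hF _ _ i.succ ?_ ?_ _) (hg i.succ i.castSucc rfl hi)
    · change j.castSucc.succAbove i.castSucc = _
      rw [Fin.succAbove_of_le_castSucc _ _ (by simpa using hi)]
      rfl
    · change j.castSucc.succAbove i.succ = _
      rw [Fin.succAbove_of_le_castSucc]
      rw [Fin.le_def] at hi ⊢
      simp at hi ⊢
      omega

end ImageStructure

/-! ### The pairing of the chains outside the latching subcomplex -/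

namespace ImageStructure

variable {E : Type u} [Category.{u} E] {V : Type} (S : ImageStructure E V)

/-- The simplices of the nerve which are not in the latching subcomplex, and whose last flag has
the same support as the part of the chain which follows it. -/
structure TypeOne where
  /-- the dimension of the corresponding simplex of type (II) -/
  n : ℕ
  /-- the chain -/
  x : ComposableArrows E (n + 1)
  /-- the position of the last flag -/
  j : Fin (n + 1)
  nd : simplex x ∈ (nerve E).nonDegenerate (n + 1)
  notMem : simplex x ∉ S.latching.obj (op ⦋n + 1⦌)
  flag : ∀ a ≤ j.castSucc, S.IsFlag x a
  not_flag : ¬ S.IsFlag x j.succ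
  supp_eq : S.supp x j.castSucc = S.supp x j.succ

namespace TypeOne

variable {S} (s : S.TypeOne)

/-- The type (II) simplex corresponding to a type (I) simplex. -/
def y : ComposableArrows E s.n := face s.j.castSucc s.x

lemma isSub : S.IsSub (s.x.obj s.j.castSucc) := (s.flag _ le_rfl).1

lemma isFirst_x : S.IsFirst s.x s.j.succ :=
  ⟨fun a ha ↦ s.flag a (Fin.le_castSucc_iff.2 ha), s.not_flag⟩

lemma isFirst_y : S.IsFirst s.y s.j := by
  refine ⟨fun a ha ↦ ?_, ?_⟩
  · refine (S.isFlag_face_iff _ _ s.isSub _).2 (s.flag _ ?_)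
    rw [Fin.succAbove_of_castSucc_lt _ _ (by simpa)]
    simpa using ha.le
  · refine fun h ↦ s.not_flag ?_
    have := (S.isFlag_face_iff _ _ s.isSub _).1 h
    rwa [Fin.succAbove_castSucc_self] at this

lemma supp_y : S.supp s.y s.j = S.supp s.x s.j.succ := by
  rw [y, S.supp_face _ _ s.isSub, Fin.succAbove_castSucc_self]

lemma supp_y_of_lt (a : Fin (s.n + 1)) (ha : a < s.j) : S.supp s.y a = S.supp s.x a.castSucc := by
  rw [y, S.supp_face _ _ s.isSub, Fin.succAbove_of_castSucc_lt _ _ (by simpa)]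

lemma obj_ne {a b : Fin (s.n + 2)} (h : a.val + 1 = b.val) (ha : S.IsSub (s.x.obj a)) :
    s.x.obj a ≠ s.x.obj b := fun e ↦
  (mem_nerve_nonDegenerate_iff _).1 s.nd a b h (S.isIdOn_of_isSub _ ha e)

/-- Otherwise two consecutive flags of `x` would be subobjects with the same image, hence equal,
against nondegeneracy. This inequality is what distinguishes type (II) from type (I). -/
lemma supp_y_ne (a : Fin (s.n + 1)) (ha : a.val + 1 = s.j.val) :
    S.supp s.y a ≠ S.supp s.y s.j := by
  have hlt : a < s.j := Fin.lt_def.2 (by omega)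
  rw [supp_y_of_lt _ _ hlt, supp_y, ← s.supp_eq]
  have h1 := s.flag a.castSucc (by simpa using hlt.le)
  exact fun h ↦ s.obj_ne (a := a.castSucc) (b := s.j.castSucc) ha h1.1
    (S.eq_of_isFlag h1 (s.flag _ le_rfl) h)

lemma obj_ne_of_flag {n : ℕ} {x : ComposableArrows E n} {a b : Fin (n + 1)} (ha : S.IsFlag x a)
    (hb : ¬ S.IsFlag x b) : x.obj a ≠ x.obj b := fun e ↦ hb (by rwa [IsFlag, ← e])

/-- The only new junction, at `j`, joins a flag to an object which is not a flag; all others are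
inherited from `x`. -/
lemma y_nonDegenerate : simplex s.y ∈ (nerve E).nonDegenerate s.n := by
  refine (mem_nerve_nonDegenerate_iff _).2 ?_
  rintro a b hab ⟨e, he⟩
  by_cases h : a.val + 1 = s.j.val
  · obtain rfl : b = s.j := Fin.ext (by omega)
    exact obj_ne_of_flag (s.isFirst_y.1 a (Fin.lt_def.2 (by omega))) s.isFirst_y.2 e
  · refine (mem_nerve_nonDegenerate_iff _).1 s.nd (s.j.castSucc.succAbove a)
      (s.j.castSucc.succAbove b) ?_ ⟨e, he⟩
    simp only [Fin.succAbove, Fin.lt_def]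
    split_ifs <;> simp at * <;> omega

/-- If the deleted flag came first, the next position has the same support; otherwise the first
object is untouched. -/
lemma y_notMem : simplex s.y ∉ S.latching.obj (op ⦋s.n⦌) := by
  refine (S.notMem_latching_iff _).2 ?_
  have h := (S.notMem_latching_iff _).1 s.notMem
  refine ⟨(S.ptSet_face _ _ s.isSub).symm ▸ h.1, ?_⟩
  rw [← h.2]
  by_cases h0 : s.j = 0
  · have h1 := s.supp_y
    have h2 := s.supp_eq
    rw [h0] at h1 h2
    exact h1.trans h2.symm
  · exact s.supp_y_of_lt 0 (Fin.pos_of_ne_zero h0)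

lemma hom_ext {s t : S.TypeOne} (hn : s.n = t.n)
    (h : SSet.S.mk (simplex s.x) = SSet.S.mk (simplex t.x)) :
    s = t := by
  have hs := s.isFirst_x
  have ht := t.isFirst_x
  obtain ⟨n, x, j, _, _, _, _, _⟩ := s
  obtain ⟨m, x', j', _, _, _, _, _⟩ := t
  dsimp only at hn h hs ht
  subst hn
  obtain rfl : x = x' := (SSet.S.ext_iff (X := nerve E) (n := n + 1) x x').1 h
  obtain rfl : j = j' := Fin.succ_injective _ (hs.unique ht)
  rfl

/-- The chain is recovered from its face: `j` is the first position of the face which is not a flag,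
and the deleted object is the subobject whose image is the support there. The morphisms starting
from flags are forced. -/
lemma hom_ext_y {s t : S.TypeOne}
    (h : SSet.S.mk (simplex s.y) = SSet.S.mk (simplex t.y)) :
    s = t := by
  have hn : s.n = t.n := SSet.S.dim_eq_of_mk_eq h
  refine hom_ext hn ?_
  have hs := s.isFirst_y
  have ht := t.isFirst_y
  have hs' := s.supp_y
  have ht' := t.supp_y
  have hs1 := s.flag
  have ht1 := t.flag
  have hs2 := s.supp_eq
  have ht2 := t.supp_eq
  unfold y at h hs ht hs' ht'
  obtain ⟨n, x, j, _, _, _, _, _⟩ := s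
  obtain ⟨m, x', j', _, _, _, _, _⟩ := t
  dsimp only at hn h hs ht hs' ht' hs1 ht1 hs2 ht2 ⊢
  subst hn
  replace h : face j.castSucc x = face j'.castSucc x' :=
    (SSet.S.ext_iff (X := nerve E) (n := n) _ _).1 h
  obtain rfl : j = j' := by
    rw [h] at hs
    exact hs.unique ht
  rw [SSet.S.ext_iff (X := nerve E) (n := n + 1)]
  have e0 : x.obj j.castSucc = x'.obj j.castSucc := by
    refine S.ext (hs1 _ le_rfl).1 (ht1 _ le_rfl).1 ?_
    rw [← (hs1 _ le_rfl).supp_eq, ← (ht1 _ le_rfl).supp_eq, hs2, ht2, ← hs', ← ht', h]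
  have e (a : Fin (n + 1)) : x.obj (j.castSucc.succAbove a) = x'.obj (j.castSucc.succAbove a) :=
    Functor.congr_obj h a
  refine S.chain_ext (fun a ↦ ?_) (fun i ↦ ?_)
  · by_cases ha : a = j.castSucc
    · rw [ha]
      exact e0
    · obtain ⟨b, rfl⟩ := Fin.exists_succAbove_eq ha
      exact e b
  · obtain hi | hi := le_or_gt i j
    · exact Or.inl (hs1 _ (by simpa using hi)).1
    · right
      have hi' : j.val < i.val := hi
      have h1 : j.castSucc.succAbove ⟨i.val - 1, (Nat.sub_le _ _).trans_lt i.isLt⟩ =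
          i.castSucc := by
        rw [Fin.succAbove_of_le_castSucc _ _ (by simp [Fin.le_def]; omega)]
        ext
        simp
        omega
      have h2 : j.castSucc.succAbove i = i.succ := by
        rw [Fin.succAbove_of_le_castSucc _ _ (by simpa using hi.le)]
      have key (p q : Fin (n + 2)) (a b : Fin (n + 1)) (hab : a ≤ b) (hpq : p ≤ q)
          (hp : j.castSucc.succAbove a = p) (hq : j.castSucc.succAbove b = q) :
          HEq (x.map (homOfLE hpq)) (x'.map (homOfLE hpq)) := by
        subst hp hq
        exact Functor.hcongr_hom h (homOfLE hab)
      exact key _ _ _ _ (Fin.le_def.2 (by simp)) _ h1 h2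

/-- The position just before the first non-flag has the same support as it in type (I), and a
different one in type (II). -/
lemma x_ne_y {s t : S.TypeOne} : SSet.S.mk (simplex s.x) ≠ SSet.S.mk (simplex t.y) := by
  intro h
  have hn : s.n + 1 = t.n := SSet.S.dim_eq_of_mk_eq h
  have hs := s.isFirst_x
  have hs' := s.supp_eq
  have ht := t.isFirst_y
  have ht' := t.supp_y_ne
  obtain ⟨n, x, j, _, _, _, _, _⟩ := s
  generalize t.y = y at h ht ht'
  generalize t.j = k at ht ht'
  generalize t.n = m at *
  subst hn
  obtain rfl : x = y := (SSet.S.ext_iff (simplex x) (simplex y)).1 h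
  obtain rfl : j.succ = k := hs.unique ht
  exact ht' j.castSucc rfl hs'

/-- If the position before the first non-flag has the same support, the chain is of type (I).
Otherwise inserting the subobject with that support gives a chain of type (I) of which the given one
is the distinguished face. -/
lemma exists_eq (n : ℕ) (y : ComposableArrows E n)
    (nd : simplex y ∈ (nerve E).nonDegenerate n)
    (notMem : simplex y ∉ S.latching.obj (op ⦋n⦌)) :
    ∃ s : S.TypeOne, SSet.S.mk (simplex y) = SSet.S.mk (simplex s.x) ∨
      SSet.S.mk (simplex y) = SSet.S.mk (simplex s.y) := by
  obtain ⟨hpt, hsupp⟩ := (S.notMem_latching_iff _).1 notMem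
  obtain ⟨j, hj⟩ := S.exists_isFirst y hpt
  by_cases h : ∃ a : Fin (n + 1), a.val + 1 = j.val ∧ S.supp y a = S.supp y j
  · obtain ⟨a, ha, ha'⟩ := h
    obtain _ | n := n
    · omega
    have hjn := j.isLt
    refine ⟨⟨n, y, ⟨a.val, by omega⟩, nd, notMem, ?_, ?_, ?_⟩, Or.inl rfl⟩
    · intro b hb
      exact hj.1 _ (Fin.lt_def.2 (by have : b.val ≤ a.val := hb; omega))
    · have hs : (⟨a.val, by omega⟩ : Fin (n + 1)).succ = j := Fin.ext ha
      rw [hs]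
      exact hj.2
    · have hs : (⟨a.val, by omega⟩ : Fin (n + 1)).succ = j := Fin.ext ha
      rw [hs]
      exact ha'
  · push Not at h
    -- The flag preceding `j`, if any, maps to `W` because supports decrease and the support of a
    -- flag is its image.
    obtain ⟨W, hW, hWT⟩ := S.exists_sub (y.obj j) (S.supp y j) Set.subset_union_left
    have hlt (a : Fin (n + 1)) (ha : a.val + 1 = j.val) : a < j := Fin.lt_def.2 (by omega)
    obtain ⟨x, hx, hxW⟩ := exists_face_eq S y j W (fun a ha ↦ (hj.1 a ha).1)
      (S.nonempty_hom hW _ (by rw [hWT]; exact Set.subset_union_left))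
      (fun a ha ↦ S.nonempty_hom (hj.1 a (hlt a ha)).1 _ (by
        rw [hWT, ← (hj.1 a (hlt a ha)).supp_eq]
        exact S.supp_subset y (hlt a ha).le))
    have hsub : S.IsSub (x.obj j.castSucc) := by rwa [hxW]
    have hpt' : S.ptSet x = S.ptSet y := by rw [← hx, S.ptSet_face _ _ hsub]
    have hflag (a : Fin (n + 1)) : S.IsFlag y a ↔ S.IsFlag x (j.castSucc.succAbove a) := by
      rw [← S.isFlag_face_iff _ _ hsub, hx]
    have hsupp' (a : Fin (n + 1)) : S.supp y a = S.supp x (j.castSucc.succAbove a) := by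
      rw [← S.supp_face _ _ hsub, hx]
    have hflagj : S.IsFlag x j.castSucc := by
      refine ⟨hsub, ?_⟩
      rw [hxW, hWT, hpt']
      exact Set.subset_union_right
    have hflaglt (a : Fin (n + 2)) (ha : a ≤ j.castSucc) : S.IsFlag x a := by
      obtain ha | rfl := ha.lt_or_eq
      · have := (hflag (a.castPred (Fin.ne_last_of_lt ha))).1 (hj.1 _ (by
          rw [Fin.lt_def] at ha ⊢; simpa using ha))
        rwa [Fin.succAbove_of_castSucc_lt _ _ (by simpa), Fin.castSucc_castPred] at this
      · exact hflagj
    have hsuppj : S.supp x j.castSucc = S.supp x j.succ := by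
      rw [hflagj.supp_eq, hxW, hWT, hsupp', Fin.succAbove_castSucc_self]
    have hnot : ¬ S.IsFlag x j.succ := by
      have := hj.2
      rwa [hflag, Fin.succAbove_castSucc_self] at this
    refine ⟨⟨n, x, j, ?_, ?_, hflaglt, hnot, hsuppj⟩, Or.inr ?_⟩
    · refine (mem_nerve_nonDegenerate_iff _).2 ?_
      rintro a b hab ⟨e, he⟩
      obtain hb | hb | hb : a.val = j.val ∨ b.val = j.val ∨ (a.val ≠ j.val ∧ b.val ≠ j.val) := by
        omega
      · obtain rfl : a = j.castSucc := Fin.ext hb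
        obtain rfl : b = j.succ := Fin.ext hab.symm
        exact obj_ne_of_flag hflagj hnot e
      · obtain rfl : b = j.castSucc := Fin.ext hb
        obtain ⟨c, rfl⟩ : ∃ c : Fin (n + 1), a = c.castSucc :=
          ⟨⟨a.val, by have := j.isLt; omega⟩, rfl⟩
        have hc : c.val + 1 = j.val := hab
        refine h c hc ?_
        rw [hsupp', hsupp', Fin.succAbove_castSucc_self, ← hsuppj,
          Fin.succAbove_of_castSucc_lt _ _ (by simpa using hlt c hc)]
        unfold supp
        rw [show x.obj c.castSucc = x.obj j.castSucc from e]
      · obtain ⟨c, rfl⟩ := Fin.exists_succAbove_eq (x := a) (y := j.castSucc)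
          (fun h ↦ hb.1 (by rw [h]; rfl))
        obtain ⟨d, rfl⟩ := Fin.exists_succAbove_eq (x := b) (y := j.castSucc)
          (fun h ↦ hb.2 (by rw [h]; rfl))
        have hcd : c.val + 1 = d.val := by
          simp only [Fin.succAbove, Fin.lt_def] at hab hb
          split_ifs at hab hb <;> simp at * <;> omega
        subst hx
        exact (mem_nerve_nonDegenerate_iff _).1 nd c d hcd ⟨e, he⟩
    · refine (S.notMem_latching_iff _).2 ⟨hpt' ▸ hpt, ?_⟩
      change S.supp x 0 = _
      rw [← hsupp]
      change _ = S.supp y 0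
      by_cases h0 : j = 0
      · subst h0
        rw [hsupp', Fin.succAbove_castSucc_self]
        exact hsuppj
      · rw [hsupp', Fin.succAbove_of_castSucc_lt _ _ (by simpa using Fin.pos_of_ne_zero h0)]
        rfl
    · rw [SSet.S.ext_iff]
      exact hx.symm

/-- The pairing of the simplices which are not in the latching subcomplex. -/
def pairingCore : S.latching.PairingCore where
  ι := S.TypeOne
  dim s := s.n
  simplex s := simplex s.x
  index s := s.j.castSucc
  nonDegenerate₁ s := s.nd
  nonDegenerate₂ s := s.y_nonDegenerate
  notMem₁ s := s.notMem
  notMem₂ s := s.y_notMem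
  injective_type₁' {s t} h := hom_ext (by
    have := SSet.S.dim_eq_of_mk_eq h
    omega) h
  injective_type₂' {s t} h := hom_ext_y h
  type₁_ne_type₂' s t := x_ne_y
  surjective' z := by
    obtain ⟨n, y, hy, hy', rfl⟩ := z.mk_surjective
    exact exists_eq n y hy hy'

/-- Equality of the two faces would identify two consecutive objects of `x`: the flag at `i` and its
successor if `i < j`, or the last flag and the non-flag after it if `i > j`. -/
lemma face_ne (s : S.TypeOne) {i : Fin (s.n + 2)} (hi : i ≠ s.j.castSucc) :
    face i s.x ≠ s.y := by
  intro h
  obtain hi | hi := lt_or_gt_of_ne hi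
  · obtain ⟨a, rfl⟩ : ∃ a : Fin (s.n + 1), i = a.castSucc := ⟨i.castPred (Fin.ne_last_of_lt hi), by simp⟩
    have h1 : s.x.obj (a.castSucc.succAbove a) = s.x.obj (s.j.castSucc.succAbove a) :=
      Functor.congr_obj h a
    rw [Fin.succAbove_castSucc_self, Fin.succAbove_of_castSucc_lt _ _ hi] at h1
    exact s.obj_ne (a := a.castSucc) (b := a.succ) rfl (s.flag _ hi.le).1 h1.symm
  · have h1 : s.x.obj (i.succAbove s.j) = s.x.obj (s.j.castSucc.succAbove s.j) :=
      Functor.congr_obj h s.j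
    rw [Fin.succAbove_castSucc_self, Fin.succAbove_of_castSucc_lt _ _ hi] at h1
    exact obj_ne_of_flag (s.flag _ le_rfl) s.not_flag h1

instance : (pairingCore (S := S)).IsProper where
  isUniquelyCodimOneFace (s : S.TypeOne) :=
    (SSet.S.IsUniquelyCodimOneFace.iff (X := nerve E) (d := s.n) (simplex s.y) (simplex s.x)).2
      ⟨s.j.castSucc, rfl, fun _ hi ↦ by_contra fun h ↦ s.face_ne h hi⟩

/-- Deleting a flag before the last one keeps the last flag and the equality of supports, which type
(II) forbids. Deleting something after the last flag keeps all flags, since points can only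
disappear; so the first non-flag moves to the right. -/
lemma lt_of_face_eq (s t : S.TypeOne) (hn : s.n = t.n) (i : Fin (t.n + 2)) (hst : s ≠ t)
    (h : SSet.S.mk (simplex (face i t.x)) = SSet.S.mk (simplex s.y)) :
    t.j.val < s.j.val := by
  have hi : i ≠ t.j.castSucc := by
    rintro rfl
    exact hst (hom_ext_y h).symm
  have hs := s.isFirst_y
  have hs' := s.supp_y_ne
  generalize s.y = y at h hs hs'
  generalize s.j = k at hs hs' ⊢
  generalize s.n = m at *
  subst hn
  obtain rfl : face i t.x = y := (SSet.S.ext_iff (simplex (face i t.x)) (simplex y)).1 h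
  obtain hi | hi := lt_or_gt_of_ne hi
  · exfalso
    have hsub := (t.flag _ hi.le).1
    have hsupp (a : Fin (t.n + 1)) (ha : t.j.val ≤ a.val + 1) :
        S.supp (face i t.x) a = S.supp t.x a.succ := by
      rw [S.supp_face _ _ hsub, Fin.succAbove_of_le_castSucc]
      rw [Fin.lt_def] at hi
      rw [Fin.le_def]
      simp at hi ⊢
      omega
    have hfirst : S.IsFirst (face i t.x) t.j := by
      constructor
      · intro a ha
        rw [S.isFlag_face_iff _ _ hsub]
        refine t.flag _ ?_
        rw [Fin.lt_def] at ha
        rw [Fin.le_def]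
        simp only [Fin.succAbove]
        split_ifs <;> simp <;> omega
      · rw [S.isFlag_face_iff _ _ hsub, Fin.succAbove_of_le_castSucc _ _ hi.le]
        exact t.not_flag
    obtain rfl := hs.unique hfirst
    have hj : 0 < t.j.val := lt_of_le_of_lt (Nat.zero_le _) hi
    have hjn := t.j.isLt
    refine hs' ⟨t.j.val - 1, by omega⟩ (by simp; omega) ?_
    rw [hsupp _ (by simp; omega), hsupp _ (by omega), ← t.supp_eq]
    congr 1
    ext
    simp
    omega
  · by_contra hk
    refine hs.2 ?_
    have h1 : i.succAbove k = k.castSucc :=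
      Fin.succAbove_of_castSucc_lt _ _ (lt_of_le_of_lt (Fin.le_def.2 (by simpa using hk)) hi)
    have h2 := t.flag k.castSucc (Fin.le_def.2 (by simpa using hk))
    rw [← h1] at h2
    exact ⟨h2.1, (S.ptSet_face_subset _ _).trans h2.2⟩

/-- The rank function of the pairing. -/
def weakRankFunction : (pairingCore (S := S)).WeakRankFunction ℕ where
  -- This counts the objects of the type (II) chain from its first non-flag on.
  rank (s : S.TypeOne) := s.n + 1 - s.j.val
  lt {s t} hst hn := by
    change S.TypeOne at s t
    change s.n = t.n at hn
    obtain ⟨hne, hlt⟩ := hst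
    obtain ⟨f, hf, hf'⟩ := SSet.N.le_iff_exists_mono.1 hlt.le
    have key : ∀ (m : ℕ) (f : ⦋m⦌ ⟶ ⦋t.n + 1⦌) [Mono f] (hm : m = t.n),
      ∃ i : Fin (t.n + 2), SSet.S.mk (simplex (face i t.x)) =
        SSet.S.mk ((nerve E).map f.op (simplex t.x)) := by
      rintro m f hf rfl
      obtain ⟨i, rfl⟩ := SimplexCategory.eq_δ_of_mono f
      exact ⟨i, rfl⟩
    obtain ⟨i, hi⟩ := @key s.n f hf hn
    have := lt_of_face_eq s t hn i hne (hi.trans (congrArg _ hf'))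
    have := s.j.isLt
    omega

end TypeOne

/-- The inclusion of the latching subcomplex is anodyne. -/
lemma anodyneExtensions_latching_ι : SSet.anodyneExtensions S.latching.ι :=
  have : (TypeOne.pairingCore (S := S)).IsRegular := TypeOne.weakRankFunction.isRegular
  (TypeOne.pairingCore (S := S)).pairing.anodyneExtensions

end ImageStructure

/-! ### Extension of maps to fibrant cosimplicial spaces -/

/-- A functional relation between the simplices of `X` and `W` which is compatible with
the simplicial operators and defined on a subcomplex `A` of `X` defines a map `A ⟶ W`. -/
lemma exists_hom_of_rel {X W : SSet.{u}} (A : X.Subcomplex)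
    (R : ∀ k, X.obj k → W.obj k → Prop) (total : ∀ k, ∀ x ∈ A.obj k, ∃ w, R k x w)
    (func : ∀ k x w w', R k x w → R k x w' → w = w')
    (stable : ∀ k l (θ : k ⟶ l) x w, R k x w → R l (X.map θ x) (W.map θ w)) :
    ∃ f : (A : SSet.{u}) ⟶ W, ∀ k (x : A.obj k), R k x.1 (f.app k x) := by
  choose w hw using total
  refine ⟨{ app k := ↾fun x ↦ w k x.1 x.2, naturality k l θ := ?_ }, fun k x ↦ hw k x.1 x.2⟩
  refine ConcreteCategory.hom_ext _ _ fun x ↦ ?_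
  exact func _ _ _ _ (hw l (X.map θ x.1) (A.map θ x.2)) (stable _ _ θ _ _ (hw k x.1 x.2))

lemma map_comp_app_apply {C : Type} [SmallCategory C] (Z : C ⥤ SSet.{u}) {a b c : C} (f : a ⟶ b)
    (g : b ⟶ c) (k) (z : (Z.obj a).obj k) :
    (Z.map (f ≫ g)).app k z = (Z.map g).app k ((Z.map f).app k z) := by
  rw [Z.map_comp]
  rfl

section

variable {D : Type} [SmallCategory D] (i : D ⥤ SimplexCategory)

/-- The functor `i` identifies `D` with a full subcategory of `Δ` which is an initial segment. -/
structure IsInitialSegment : Prop where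
  full : i.Full
  faithful : i.Faithful
  ext {d d' : D} (h : (i.obj d).len = (i.obj d').len) : d = d'
  exists_iso (d : D) (p : SimplexCategory) (h : p.len ≤ (i.obj d).len) :
    ∃ e, Nonempty (i.obj e ≅ p)

namespace IsInitialSegment

variable {i} (hi : IsInitialSegment i)

include hi

lemma exists_fac {d d' : D} (f : d ⟶ d') :
    ∃ (e : D) (p : d ⟶ e) (m : e ⟶ d'), Epi (i.map p) ∧ Mono (i.map m) ∧ p ≫ m = f := by
  have := hi.full
  have := hi.faithful
  obtain ⟨e, ⟨iso⟩⟩ := hi.exists_iso d' (Limits.image (i.map f))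
    (SimplexCategory.len_le_of_mono (Limits.image.ι (i.map f)))
  refine ⟨e, i.preimage (Limits.factorThruImage (i.map f) ≫ iso.inv),
    i.preimage (iso.hom ≫ Limits.image.ι (i.map f)), ?_, ?_, i.map_injective (by simp)⟩
  · rw [i.map_preimage]
    exact epi_comp _ _
  · rw [i.map_preimage]
    exact mono_comp _ _

lemma eq_of_epi {d e : D} (p : d ⟶ e) [Epi (i.map p)] (h : (i.obj d).len ≤ (i.obj e).len) :
    ∃ h : d = e, p = eqToHom h := by
  obtain rfl := hi.ext (h.antisymm (SimplexCategory.len_le_of_epi (i.map p)))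
  have := hi.faithful
  exact ⟨rfl, i.map_injective (by simpa using SimplexCategory.eq_id_of_epi (i.map p))⟩

lemma eq_of_mono {d e : D} (p : d ⟶ e) [Mono (i.map p)] (h : (i.obj e).len ≤ (i.obj d).len) :
    ∃ h : d = e, p = eqToHom h := by
  obtain rfl := hi.ext ((SimplexCategory.len_le_of_mono (i.map p)).antisymm h)
  have := hi.faithful
  exact ⟨rfl, i.map_injective (by simpa using SimplexCategory.eq_id_of_mono (i.map p))⟩

end IsInitialSegment

variable {i}

/-- The matching space is indexed by quotients in all of `Δ`, but each of them is isomorphic to some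
`i e`, and its component is determined by the one at `i e`. -/
lemma IsInitialSegment.matchingSpace_ext (hi : IsInitialSegment i) {Z : SimplexCategory ⥤ SSet.{u}}
    {d : D} {k} {w w' : (matchingSpace Z (i.obj d)).obj k}
    (h : ∀ (e : D) (p : d ⟶ e) (hp : Epi (i.map p)) (he : (i.obj e).len < (i.obj d).len),
      w.1 (i.obj e) (i.map p) hp he = w'.1 (i.obj e) (i.map p) hp he) : w = w' := by
  apply Subtype.ext
  funext p σ hσ hp
  have := hi.full
  obtain ⟨e, ⟨iso⟩⟩ := hi.exists_iso d p hp.le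
  obtain ⟨p₀, rfl⟩ : ∃ p₀ : d ⟶ e, i.map p₀ ≫ iso.hom = σ := ⟨i.preimage (σ ≫ iso.inv), by simp⟩
  have hp₀ : Epi (i.map p₀) := by
    have := epi_comp (i.map p₀ ≫ iso.hom) iso.inv
    simpa using this
  have he : (i.obj e).len < (i.obj d).len :=
    (SimplexCategory.len_le_of_mono iso.hom).trans_lt hp
  rw [← w.2 _ _ (i.map p₀) iso.hom hp₀ he hσ hp, ← w'.2 _ _ (i.map p₀) iso.hom hp₀ he hσ hp,
    h e p₀ hp₀ he]

/-- The latching subcomplex of a diagram of spaces. -/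
def latchingSubcomplex (i : D ⥤ SimplexCategory) (P : D ⥤ SSet.{u}) (d : D) :
    (P.obj d).Subcomplex where
  obj k := { x | ∃ (e : D) (m : e ⟶ d) (_ : (i.obj e).len < (i.obj d).len) (_ : Mono (i.map m))
    (x₀ : (P.obj e).obj k), (P.map m).app k x₀ = x }
  map {k l} θ x := by
    rintro ⟨e, m, h, h', x₀, rfl⟩
    exact ⟨e, m, h, h', (P.obj e).map θ x₀, NatTrans.naturality_apply _ _ _⟩

/-- A diagram of spaces is Reedy cofibrant (relatively to `i`) if any simplex is the image of a
smallest one. -/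
def HasMinimalSimplices (i : D ⥤ SimplexCategory) (P : D ⥤ SSet.{u}) : Prop :=
  ∀ (d : D) (k) (x : (P.obj d).obj k), ∃ (e₀ : D) (m₀ : e₀ ⟶ d) (x₀ : (P.obj e₀).obj k),
    Mono (i.map m₀) ∧ (P.map m₀).app k x₀ = x ∧
      ∀ (e : D) (m : e ⟶ d) (y : (P.obj e).obj k), Mono (i.map m) → (P.map m).app k y = x →
        ∃ n : e₀ ⟶ e, n ≫ m = m₀ ∧ (P.map n).app k x₀ = y

/-- A partially defined natural transformation. -/
structure PartialHom (P R : D ⥤ SSet.{u}) where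
  /-- the domain of definition -/
  Q (d : D) : (P.obj d).Subcomplex
  le_preimage {d d' : D} (f : d ⟶ d') : Q d ≤ (Q d').preimage (P.map f)
  /-- the maps -/
  φ (d : D) : (Q d : SSet.{u}) ⟶ R.obj d
  nat {d d' : D} (f : d ⟶ d') (k) (x : (P.obj d).obj k) (hx : x ∈ (Q d).obj k) :
    (R.map f).app k ((φ d).app k ⟨x, hx⟩) =
      (φ d').app k ⟨(P.map f).app k x, le_preimage f k hx⟩

variable {Z : SimplexCategory ⥤ SSet.{u}} {P : D ⥤ SSet.{u}} (F : PartialHom P (i ⋙ Z))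

/-- An extension of a partially defined natural transformation to all objects of
degree `< N`. -/
structure TruncatedExtension (N : ℕ) where
  /-- the maps -/
  ℓ (d : D) (hd : (i.obj d).len < N) : P.obj d ⟶ Z.obj (i.obj d)
  ι_ℓ (d : D) (hd : (i.obj d).len < N) : (F.Q d).ι ≫ ℓ d hd = F.φ d
  nat {d d' : D} (f : d ⟶ d') (hd : (i.obj d).len < N) (hd' : (i.obj d').len < N) :
    ℓ d hd ≫ Z.map (i.map f) = P.map f ≫ ℓ d' hd'

/-! ### The inductive step of the extension -/

namespace TruncatedExtension

variable {F} {N : ℕ} (T : TruncatedExtension F N)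

lemma nat_apply {d d' : D} (f : d ⟶ d') (hd : (i.obj d).len < N) (hd' : (i.obj d').len < N)
    (k) (x : (P.obj d).obj k) :
    (Z.map (i.map f)).app k ((T.ℓ d hd).app k x) = (T.ℓ d' hd').app k ((P.map f).app k x) :=
  ConcreteCategory.congr_hom (NatTrans.congr_app (T.nat f hd hd') k) x

lemma ι_ℓ_apply (d : D) (hd : (i.obj d).len < N) (k) (x : (P.obj d).obj k)
    (hx : x ∈ (F.Q d).obj k) : (T.ℓ d hd).app k x = (F.φ d).app k ⟨x, hx⟩ :=
  ConcreteCategory.congr_hom (NatTrans.congr_app (T.ι_ℓ d hd) k) ⟨x, hx⟩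

/-- The composite of the desired extension at `d` with the matching map is already dictated by the
extension in lower degrees. -/
lemma exists_matching (hi : IsInitialSegment i) (d : D) (hd : (i.obj d).len ≤ N) :
    ∃ b : P.obj d ⟶ matchingSpace Z (i.obj d), ∀ (e : D) (p : d ⟶ e) (hp : Epi (i.map p))
      (he : (i.obj e).len < (i.obj d).len) (k) (x : (P.obj d).obj k),
      (b.app k x).1 (i.obj e) (i.map p) hp he =
        (T.ℓ e (he.trans_le hd)).app k ((P.map p).app k x) := by
  have := hi.full
  have := hi.faithful
  have h (p : SimplexCategory) (hp : p.len < (i.obj d).len) :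
    ∃ e, Nonempty (i.obj e ≅ p) := hi.exists_iso d p hp.le
  choose e iso using h
  replace iso (p : SimplexCategory) (hp : p.len < (i.obj d).len) := (iso p hp).some
  have he (p : SimplexCategory) (hp : p.len < (i.obj d).len) : (i.obj (e p hp)).len < N := by
    have := SimplexCategory.len_le_of_mono (iso p hp).hom
    omega
  -- The component at `σ` is defined through a chosen `i e ≅ p`; pushing it forward along `g`
  -- removes the choice.
  have key {p : SimplexCategory} (hp : p.len < (i.obj d).len) (σ : i.obj d ⟶ p) {e' : D}
      (he' : (i.obj e').len < N) (g : p ⟶ i.obj e') (k) (x : (P.obj d).obj k) :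
      (Z.map g).app k ((Z.map (iso p hp).hom).app k ((T.ℓ (e p hp) (he p hp)).app k
        ((P.map (i.preimage (σ ≫ (iso p hp).inv))).app k x))) =
      (T.ℓ e' he').app k ((P.map (i.preimage (σ ≫ g))).app k x) := by
    have h1 := T.nat_apply (i.preimage ((iso p hp).hom ≫ g)) (he p hp) he' k
      ((P.map (i.preimage (σ ≫ (iso p hp).inv))).app k x)
    rw [i.map_preimage, Z.map_comp] at h1
    refine h1.trans ?_
    have h2 : i.preimage (σ ≫ (iso p hp).inv) ≫ i.preimage ((iso p hp).hom ≫ g) =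
      i.preimage (σ ≫ g) := i.map_injective (by simp)
    rw [← h2, P.map_comp]
    rfl
  refine ⟨{
    app k := ↾fun x ↦ ⟨fun p σ _ hp ↦ (Z.map (iso p hp).hom).app k
      ((T.ℓ (e p hp) (he p hp)).app k ((P.map (i.preimage (σ ≫ (iso p hp).inv))).app k x)), ?_⟩
    naturality k l θ := ?_ }, ?_⟩
  · intro p q σ τ hσ hp hστ hq
    have h1 := key hp σ (he q hq) (τ ≫ (iso q hq).inv) k x
    rw [← Category.assoc, map_comp_app_apply] at h1
    have h2 := congrArg ((Z.map (iso q hq).hom).app k) h1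
    rw [← map_comp_app_apply, Iso.inv_hom_id, Z.map_id] at h2
    exact h2
  · refine ConcreteCategory.hom_ext _ _ fun x ↦ ?_
    apply Subtype.ext
    funext p σ hσ hp
    change (Z.map (iso p hp).hom).app l ((T.ℓ (e p hp) (he p hp)).app l
      ((P.map (i.preimage (σ ≫ (iso p hp).inv))).app l ((P.obj d).map θ x))) =
      (Z.obj p).map θ ((Z.map (iso p hp).hom).app k ((T.ℓ (e p hp) (he p hp)).app k
      ((P.map (i.preimage (σ ≫ (iso p hp).inv))).app k x)))
    rw [NatTrans.naturality_apply, NatTrans.naturality_apply, NatTrans.naturality_apply]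
  · intro e' p hp he' k x
    have h1 := key he' (i.map p) (he'.trans_le hd) (𝟙 _) k x
    rw [Category.comp_id, i.preimage_map] at h1
    rw [← h1, Z.map_id]
    rfl

/-- The values which are prescribed on the latching subcomplex and on the domain of definition. -/
def Prescribed (d : D) (hd : (i.obj d).len ≤ N) (k) (x : (P.obj d).obj k)
    (z : (Z.obj (i.obj d)).obj k) : Prop :=
  (∃ hx : x ∈ (F.Q d).obj k, z = (F.φ d).app k ⟨x, hx⟩) ∨
    ∃ (e : D) (m : e ⟶ d) (he : (i.obj e).len < (i.obj d).len) (_ : Mono (i.map m))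
      (x₀ : (P.obj e).obj k), (P.map m).app k x₀ = x ∧
        z = (Z.map (i.map m)).app k ((T.ℓ e (he.trans_le hd)).app k x₀)

/-- The domain of definition is compatible with monomorphisms. -/
def _root_.CosimplicialSpace.PartialHom.IsSaturated {R : D ⥤ SSet.{u}} (i : D ⥤ SimplexCategory)
    (F : PartialHom P R) : Prop :=
  ∀ ⦃e d : D⦄ (m : e ⟶ d) (_ : Mono (i.map m)) (k) (x : (P.obj e).obj k),
    (P.map m).app k x ∈ (F.Q d).obj k → x ∈ (F.Q e).obj k

/-- Two values coming from faces are both images of the value at the smallest simplex underlying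
`x`. A face meeting the domain of definition lies in it by saturation, where the extension is `F.φ`.
-/
lemma prescribed_unique (hP : HasMinimalSimplices i P) (hF : F.IsSaturated i)
    (d : D) (hd : (i.obj d).len ≤ N) (k) (x : (P.obj d).obj k)
    (z z' : (Z.obj (i.obj d)).obj k) (h : T.Prescribed d hd k x z)
    (h' : T.Prescribed d hd k x z') : z = z' := by
  have key (hx : x ∈ (F.Q d).obj k) {e : D} (m : e ⟶ d) (he : (i.obj e).len < (i.obj d).len)
      (hm : Mono (i.map m)) (x₀ : (P.obj e).obj k) (hx₀ : (P.map m).app k x₀ = x) :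
      (Z.map (i.map m)).app k ((T.ℓ e (he.trans_le hd)).app k x₀) = (F.φ d).app k ⟨x, hx⟩ := by
    subst hx₀
    rw [T.ι_ℓ_apply e _ k x₀ (hF m hm k x₀ hx)]
    exact F.nat m k x₀ _
  obtain ⟨hx, rfl⟩ | ⟨e, m, he, hm, x₀, hx₀, rfl⟩ := h <;>
    obtain ⟨hx', rfl⟩ | ⟨e', m', he', hm', x₀', hx₀', rfl⟩ := h'
  · rfl
  · exact (key hx _ he' hm' _ hx₀').symm
  · exact key hx' _ he hm _ hx₀
  · obtain ⟨e₀, m₀, y, hm₀, -, h⟩ := hP d k x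
    have key' {e : D} (m : e ⟶ d) (he : (i.obj e).len < (i.obj d).len)
        (hm : Mono (i.map m)) (x₀ : (P.obj e).obj k) (hx₀ : (P.map m).app k x₀ = x) :
        ∃ he₀ : (i.obj e₀).len < N, (Z.map (i.map m)).app k ((T.ℓ e (he.trans_le hd)).app k x₀) =
          (Z.map (i.map m₀)).app k ((T.ℓ e₀ he₀).app k y) := by
      obtain ⟨n, rfl, rfl⟩ := h e m x₀ hm hx₀
      have : Mono (i.map n) := by
        rw [i.map_comp] at hm₀
        exact mono_of_mono _ (i.map m)
      have := SimplexCategory.len_le_of_mono (i.map n)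
      refine ⟨by omega, ?_⟩
      rw [← T.nat_apply n (by omega) _ k y, i.map_comp, Z.map_comp]
      rfl
    exact (key' m he hm x₀ hx₀).choose_spec.trans (key' m' he' hm' x₀' hx₀').choose_spec.symm

lemma prescribed_map (d : D) (hd : (i.obj d).len ≤ N) (k l) (θ : k ⟶ l) (x : (P.obj d).obj k)
    (z : (Z.obj (i.obj d)).obj k) (h : T.Prescribed d hd k x z) :
    T.Prescribed d hd l ((P.obj d).map θ x) ((Z.obj (i.obj d)).map θ z) := by
  obtain ⟨hx, rfl⟩ | ⟨e, m, he, hm, x₀, rfl, rfl⟩ := h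
  · exact Or.inl ⟨(F.Q d).map θ hx, (NatTrans.naturality_apply (F.φ d) θ ⟨x, hx⟩).symm⟩
  · refine Or.inr ⟨e, m, he, hm, (P.obj e).map θ x₀, NatTrans.naturality_apply _ _ _, ?_⟩
    rw [NatTrans.naturality_apply, NatTrans.naturality_apply]

/-- Lift the prescribed values against the matching map. The upper triangle gives compatibility with
`F.φ` and with monos, the lower one compatibility with epis. -/
lemma exists_extension_obj (hi : IsInitialSegment i) (hZ : IsFibrantCosimplicial Z)
    (hP : HasMinimalSimplices i P) (hF : F.IsSaturated i) (d : D) (hd : (i.obj d).len ≤ N)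
    (hd' : SSet.anodyneExtensions (F.Q d ⊔ latchingSubcomplex i P d).ι) :
    ∃ f : P.obj d ⟶ Z.obj (i.obj d), (F.Q d).ι ≫ f = F.φ d ∧
      (∀ (e : D) (m : e ⟶ d) (_ : Mono (i.map m)) (he : (i.obj e).len < (i.obj d).len),
        T.ℓ e (he.trans_le hd) ≫ Z.map (i.map m) = P.map m ≫ f) ∧
      (∀ (e : D) (p : d ⟶ e) (_ : Epi (i.map p)) (he : (i.obj e).len < (i.obj d).len),
        f ≫ Z.map (i.map p) = P.map p ≫ T.ℓ e (he.trans_le hd)) := by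
  obtain ⟨b, hb⟩ := T.exists_matching hi d hd
  obtain ⟨t, ht⟩ := exists_hom_of_rel (F.Q d ⊔ latchingSubcomplex i P d) (T.Prescribed d hd)
    (by
      rintro k x (hx | ⟨e, m, he, hm, x₀, hx₀⟩)
      · exact ⟨_, Or.inl ⟨hx, rfl⟩⟩
      · exact ⟨_, Or.inr ⟨e, m, he, hm, x₀, hx₀, rfl⟩⟩)
    (T.prescribed_unique hP hF d hd) (T.prescribed_map d hd)
  have sq : CommSq t (F.Q d ⊔ latchingSubcomplex i P d).ι (matchingMap Z (i.obj d)) b := by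
    constructor
    apply NatTrans.ext
    funext k
    refine ConcreteCategory.hom_ext _ _ fun x ↦ ?_
    refine hi.matchingSpace_ext fun e p hp he ↦ ?_
    change (Z.map (i.map p)).app k (t.app k x) = (b.app k x.1).1 _ _ _ _
    rw [hb]
    obtain ⟨hx, h⟩ | ⟨e', m, he', hm, x₀, hx₀, h⟩ := ht k x
    · rw [h, T.ι_ℓ_apply _ _ _ _ (F.le_preimage p k hx)]
      exact F.nat p k x.1 hx
    · rw [h, ← hx₀, ← map_comp_app_apply, ← map_comp_app_apply, ← i.map_comp]
      exact T.nat_apply _ _ _ _ _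
  have := hZ (i.obj d)
  have := hd' (matchingMap Z (i.obj d)) ((HomotopicalAlgebra.fibration_iff _).1 this)
  have hl (k) (x : (P.obj d).obj k) (hx : x ∈ (F.Q d ⊔ latchingSubcomplex i P d).obj k) :
      T.Prescribed d hd k x (sq.lift.app k x) := by
    have := ConcreteCategory.congr_hom (NatTrans.congr_app sq.fac_left k) ⟨x, hx⟩
    have h2 := ht k ⟨x, hx⟩
    rwa [← this] at h2
  refine ⟨sq.lift, ?_, fun e m hm he ↦ ?_, fun e p hp he ↦ ?_⟩
  · apply NatTrans.ext
    funext k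
    refine ConcreteCategory.hom_ext _ _ fun x ↦ ?_
    exact T.prescribed_unique hP hF d hd k x.1 _ _ (hl k x.1 (Or.inl x.2)) (Or.inl ⟨x.2, rfl⟩)
  · apply NatTrans.ext
    funext k
    refine ConcreteCategory.hom_ext _ _ fun x ↦ ?_
    exact T.prescribed_unique hP hF d hd k _ _ _ (Or.inr ⟨e, m, he, hm, x, rfl, rfl⟩)
      (hl k _ (Or.inr ⟨e, m, he, hm, x, rfl⟩))
  · apply NatTrans.ext
    funext k
    refine ConcreteCategory.hom_ext _ _ fun x ↦ ?_
    have := ConcreteCategory.congr_hom (NatTrans.congr_app sq.fac_right k) x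
    have := congrFun (congrFun (congrFun (congrFun (congrArg Subtype.val this)
      (i.obj e)) (i.map p)) hp) he
    exact this.trans (hb e p hp he k x)

/-- By epi-mono factorization, naturality need only be checked on epis and monos. Those that change
the degree were handled by the lifting problem; the others are identities. -/
lemma exists_succ (hi : IsInitialSegment i) (hZ : IsFibrantCosimplicial Z)
    (hP : HasMinimalSimplices i P) (hF : F.IsSaturated i)
    (hd : ∀ d, SSet.anodyneExtensions (F.Q d ⊔ latchingSubcomplex i P d).ι) :
    ∃ T' : TruncatedExtension F (N + 1), ∀ (d : D) (h : (i.obj d).len < N),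
      T'.ℓ d (h.trans N.lt_succ_self) = T.ℓ d h := by
  choose f hf₁ hf₂ hf₃ using fun (d : D) (h : (i.obj d).len ≤ N) ↦
    T.exists_extension_obj hi hZ hP hF d h (hd d)
  let ℓ (d : D) (h : (i.obj d).len < N + 1) : P.obj d ⟶ Z.obj (i.obj d) :=
    if h' : (i.obj d).len < N then T.ℓ d h' else f d (Nat.le_of_lt_succ h)
  have hℓ (d : D) (h' : (i.obj d).len < N) (h) : ℓ d h = T.ℓ d h' := dif_pos h'
  have hℓ' (d : D) (h' : ¬ (i.obj d).len < N) (h) : ℓ d h = f d (Nat.le_of_lt_succ h) :=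
    dif_neg h'
  have hepi {d e : D} (p : d ⟶ e) (_ : Epi (i.map p)) (h : (i.obj d).len < N + 1)
      (h' : (i.obj e).len < N + 1) : ℓ d h ≫ Z.map (i.map p) = P.map p ≫ ℓ e h' := by
    by_cases he : (i.obj e).len < (i.obj d).len
    · rw [hℓ e (by omega) h']
      by_cases h₁ : (i.obj d).len < N
      · rw [hℓ d h₁ h, T.nat]
      · rw [hℓ' d h₁ h, hf₃ d _ e p inferInstance he]
    · obtain ⟨rfl, rfl⟩ := hi.eq_of_epi p (by omega)
      simp
  have hmono {d e : D} (p : d ⟶ e) (_ : Mono (i.map p)) (h : (i.obj d).len < N + 1)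
      (h' : (i.obj e).len < N + 1) : ℓ d h ≫ Z.map (i.map p) = P.map p ≫ ℓ e h' := by
    by_cases he : (i.obj d).len < (i.obj e).len
    · rw [hℓ d (by omega) h]
      by_cases h₁ : (i.obj e).len < N
      · rw [hℓ e h₁ h', T.nat]
      · rw [hℓ' e h₁ h', hf₂ e _ d p inferInstance he]
    · obtain ⟨rfl, rfl⟩ := hi.eq_of_mono p (by omega)
      simp
  refine ⟨⟨ℓ, fun d h ↦ ?_, fun {d d'} g h h' ↦ ?_⟩, fun d h ↦ hℓ d h (h.trans N.lt_succ_self)⟩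
  · by_cases h₁ : (i.obj d).len < N
    · rw [hℓ d h₁ h, T.ι_ℓ]
    · rw [hℓ' d h₁ h, hf₁]
  · obtain ⟨e, p, m, hp, hm, rfl⟩ := hi.exists_fac g
    have he := SimplexCategory.len_le_of_mono (i.map m)
    rw [i.map_comp, Z.map_comp, P.map_comp, ← Category.assoc, hepi p hp h (he.trans_lt h'),
      Category.assoc, hmono m hm (he.trans_lt h') h', Category.assoc]

end TruncatedExtension

/-- A partially defined natural transformation to a fibrant cosimplicial space extends if the
relative latching maps are anodyne. -/
theorem exists_extension (hi : IsInitialSegment i) (hZ : IsFibrantCosimplicial Z)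
    (hP : HasMinimalSimplices i P) (hF : F.IsSaturated i)
    (hd : ∀ d, SSet.anodyneExtensions (F.Q d ⊔ latchingSubcomplex i P d).ι) :
    ∃ Φ : P ⟶ i ⋙ Z, ∀ d, (F.Q d).ι ≫ Φ.app d = F.φ d := by
  choose next hnext using fun (N : ℕ) (T : TruncatedExtension F N) ↦
    T.exists_succ hi hZ hP hF hd
  -- Stage `0` is vacuous, and the value at `d` no longer changes from stage `deg d + 1` on.
  let T (N : ℕ) : TruncatedExtension F N :=
    Nat.rec ⟨fun _ h ↦ (Nat.not_lt_zero _ h).elim, fun _ h ↦ (Nat.not_lt_zero _ h).elim,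
      fun _ h ↦ (Nat.not_lt_zero _ h).elim⟩ next N
  have hT (d : D) (N : ℕ) (h : (i.obj d).len < N) :
      (T N).ℓ d h = (T ((i.obj d).len + 1)).ℓ d (Nat.lt_succ_self _) := by
    obtain ⟨k, rfl⟩ := Nat.exists_eq_add_of_le (Nat.succ_le_of_lt h)
    induction k with
    | zero => rfl
    | succ k hk =>
      rw [← hk (by omega)]
      exact hnext _ (T (((i.obj d).len + 1) + k)) d (by omega)
  refine ⟨{
    app d := (T ((i.obj d).len + 1)).ℓ d (Nat.lt_succ_self _)
    naturality d d' f := ?_ }, fun d ↦ (T ((i.obj d).len + 1)).ι_ℓ d (Nat.lt_succ_self _)⟩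
  have h := (T ((i.obj d).len + (i.obj d').len + 1)).nat f (by omega) (by omega)
  rw [hT d _ (by omega), hT d' _ (by omega)] at h
  exact h.symm

end

/-! ### Weak equivalences -/

/-- Two maps of simplicial sets are directly homotopic if there is a homotopy from the first
to the second. -/
def DirectlyHomotopic {X Y : SSet.{u}} (f g : X ⟶ Y) : Prop :=
  ∃ H : X ⊗ Δ[1] ⟶ Y, SSet.ι₀ ≫ H = f ∧ SSet.ι₁ ≫ H = g

lemma DirectlyHomotopic.refl {X Y : SSet.{u}} (f : X ⟶ Y) : DirectlyHomotopic f f :=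
  ⟨CartesianMonoidalCategory.fst _ _ ≫ f, rfl, rfl⟩

lemma DirectlyHomotopic.mapπ₀_pre_eq {X Y : SSet.{u}} {f g : X ⟶ Y} (h : DirectlyHomotopic f g)
    (K : SSet.{u}) :
    SSet.mapπ₀ ((MonoidalClosed.pre f).app K) = SSet.mapπ₀ ((MonoidalClosed.pre g).app K) := by
  obtain ⟨H, rfl, rfl⟩ := h
  funext v
  obtain ⟨v, rfl⟩ := SSet.π₀.mk_surjective v
  obtain ⟨v, rfl⟩ := SSet.yonedaEquiv.surjective v
  obtain ⟨ψ, rfl⟩ : ∃ ψ, MonoidalClosed.curry ψ = v := ⟨MonoidalClosed.uncurry v, by simp⟩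
  -- The edge of `hom(X, K)` adjoint to `H` followed by the vertex `ψ`. A vertex of the internal hom
  -- is a map out of `Δ[0]`, whence the constant second component.
  let e : Δ[1] ⟶ (ihom X).obj K :=
    MonoidalClosed.curry (CartesianMonoidalCategory.lift H (SSet.const
      (SSet.stdSimplex.obj₀Equiv.symm 0)) ≫ ψ)
  have key (j : X ⟶ X ⊗ Δ[1]) (a : Fin 2)
      (h : X ◁ SSet.stdSimplex.δ a ≫ CartesianMonoidalCategory.lift H (SSet.const
      (SSet.stdSimplex.obj₀Equiv.symm 0)) = (j ≫ H) ▷ Δ[0]) :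
      ((ihom X).obj K).δ a (SSet.yonedaEquiv e) =
        ((MonoidalClosed.pre (j ≫ H)).app K).app _ (SSet.yonedaEquiv (MonoidalClosed.curry ψ)) := by
    have h1 : SSet.stdSimplex.δ a ≫ e =
        MonoidalClosed.curry ψ ≫ (MonoidalClosed.pre (j ≫ H)).app K := by
      rw [MonoidalClosed.curry_pre_app, ← h, ← MonoidalClosed.curry_natural_left,
        Category.assoc]
    refine Eq.trans ?_ ((congrArg SSet.yonedaEquiv h1).trans (SSet.yonedaEquiv_comp _ _))
    obtain ⟨x, hx⟩ := SSet.yonedaEquiv.symm.surjective e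
    rw [← hx, Equiv.apply_symm_apply]
    rfl
  -- The face `δ a` omits the vertex `a`, so the end `ι₀` is the face `1` and the end `ι₁` is the
  -- face `0`.
  rw [SSet.mapπ₀_mk, SSet.mapπ₀_mk, ← key SSet.ι₀ 1, ← key SSet.ι₁ 0]
  · exact SSet.π₀.sound (SSet.Edge.mk' _)
  all_goals
    apply NatTrans.ext
    funext k
    refine ConcreteCategory.hom_ext _ _ fun x ↦ ?_
    obtain ⟨x, y⟩ := x
    refine Prod.ext (congrArg (fun t ↦ H.app k (x, t)) ?_) ?_
    · apply SSet.stdSimplex.objEquiv.injective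
      apply SimplexCategory.Hom.ext
      apply OrderHom.ext
      funext j
      have hy : (SSet.stdSimplex.objEquiv y).toOrderHom j = 0 :=
        Subsingleton.elim (α := Fin 1) _ _
      first
        | exact congrArg (SimplexCategory.δ (n := 0) 1).toOrderHom hy
        | exact congrArg (SimplexCategory.δ (n := 0) 0).toOrderHom hy
    · apply SSet.stdSimplex.objEquiv.injective
      apply SimplexCategory.Hom.ext
      apply OrderHom.ext
      funext j
      exact Subsingleton.elim (α := Fin 1) _ _

lemma IsWeakEquivalence.comp {X Y Z : SSet.{u}} {f : X ⟶ Y} {g : Y ⟶ Z}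
    (hf : IsWeakEquivalence f) (hg : IsWeakEquivalence g) : IsWeakEquivalence (f ≫ g) := by
  intro K hK
  convert! (hf K hK).comp (hg K hK) using 1
  funext v
  rw [MonoidalClosed.pre_map]
  exact SSet.mapπ₀_comp_apply _ _ _

lemma isWeakEquivalence_of_directlyHomotopic {X Y : SSet.{u}} {f : X ⟶ Y} {g : Y ⟶ X}
    (h : DirectlyHomotopic (𝟙 X) (f ≫ g)) (h' : DirectlyHomotopic (𝟙 Y) (g ≫ f)) :
    IsWeakEquivalence f := by
  intro K _
  have key {X Y : SSet.{u}} {f : X ⟶ Y} {g : Y ⟶ X} (h : DirectlyHomotopic (𝟙 X) (f ≫ g)) :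
      Function.LeftInverse (SSet.mapπ₀ ((MonoidalClosed.pre f).app K))
        (SSet.mapπ₀ ((MonoidalClosed.pre g).app K)) := by
    intro v
    rw [← SSet.mapπ₀_comp_apply, ← NatTrans.comp_app, ← MonoidalClosed.pre_map,
      ← h.mapπ₀_pre_eq, MonoidalClosed.pre_id]
    exact SSet.mapπ₀_id_apply v
  exact ⟨(key h').injective, (key h).surjective⟩

lemma isWeakEquivalence_of_isIso {X Y : SSet.{u}} (f : X ⟶ Y) [IsIso f] :
    IsWeakEquivalence f := by
  refine isWeakEquivalence_of_directlyHomotopic (g := inv f) ?_ ?_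
  · rw [IsIso.hom_inv_id]
    exact .refl _
  · rw [IsIso.inv_hom_id]
    exact .refl _

/-- Lifting against `∅ ⟶ Y` gives a section `s`; lifting against `X × ∂Δ[1] ⟶ X × Δ[1]` gives a
homotopy from the identity to `p ≫ s`. -/
lemma isWeakEquivalence_of_rlp {X Y : SSet.{u}} (p : X ⟶ Y)
    (hp : (MorphismProperty.monomorphisms SSet.{u}).rlp p) : IsWeakEquivalence p := by
  obtain ⟨s, hs⟩ : ∃ s : Y ⟶ X, s ≫ p = 𝟙 Y := by
    have := hp (Limits.initial.to Y) (MorphismProperty.monomorphisms.infer_property _)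
    have sq : CommSq (Limits.initial.to X) (Limits.initial.to Y) p (𝟙 Y) := ⟨by simp⟩
    exact ⟨sq.lift, sq.fac_right⟩
  refine isWeakEquivalence_of_directlyHomotopic (g := s) ?_ (by rw [hs]; exact .refl _)
  let A : (X ⊗ Δ[1]).Subcomplex := SSet.Subcomplex.range SSet.ι₀ ⊔ SSet.Subcomplex.range SSet.ι₁
  obtain ⟨t, ht⟩ := exists_hom_of_rel (W := X) A (fun k y w ↦ SSet.ι₀.app k w = y ∨
    ∃ x, SSet.ι₁.app k x = y ∧ w = s.app k (p.app k x))
    (by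
      rintro k _ (⟨x, rfl⟩ | ⟨x, rfl⟩)
      · exact ⟨x, Or.inl rfl⟩
      · exact ⟨_, Or.inr ⟨x, rfl, rfl⟩⟩)
    (by
      have h01 (k) (x y : X.obj k) : SSet.ι₀.app k x ≠ SSet.ι₁.app k y := by
        intro h
        have := congrArg (fun z : (X ⊗ Δ[1]).obj k ↦ (SSet.stdSimplex.objEquiv z.2).toOrderHom 0) h
        exact zero_ne_one this
      rintro k y w w' (h | ⟨x, rfl, rfl⟩) (h' | ⟨x', h', rfl⟩)
      · exact congrArg Prod.fst (h.trans h'.symm)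
      · exact (h01 _ _ _ (h.trans h'.symm)).elim
      · exact (h01 _ _ _ h').elim
      · have : x' = x := congrArg Prod.fst h'
        rw [this])
    (by
      rintro k l θ y w (rfl | ⟨x, rfl, rfl⟩)
      · exact Or.inl (NatTrans.naturality_apply _ _ _)
      · exact Or.inr ⟨X.map θ x, NatTrans.naturality_apply _ _ _, by
          rw [NatTrans.naturality_apply, NatTrans.naturality_apply]⟩)
  have sq : CommSq t A.ι p (CartesianMonoidalCategory.fst _ _ ≫ p) := by
    constructor
    apply NatTrans.ext
    funext k
    refine ConcreteCategory.hom_ext _ _ fun x ↦ ?_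
    change p.app k (t.app k x) = p.app k x.1.1
    obtain h | ⟨y, hy, h⟩ := ht k x
    · rw [← h]
      rfl
    · rw [h, ← hy]
      exact ConcreteCategory.congr_hom (NatTrans.congr_app hs k) _
  have := hp A.ι (MorphismProperty.monomorphisms.infer_property _)
  have hl (k) (x : A.obj k) : sq.lift.app k x.1 = t.app k x :=
    ConcreteCategory.congr_hom (NatTrans.congr_app sq.fac_left k) x
  have h01 (k) (x y : X.obj k) : SSet.ι₀.app k x ≠ SSet.ι₁.app k y := by
    intro h
    have := congrArg (fun z : (X ⊗ Δ[1]).obj k ↦ (SSet.stdSimplex.objEquiv z.2).toOrderHom 0) h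
    exact zero_ne_one this
  refine ⟨sq.lift, ?_, ?_⟩
  · apply NatTrans.ext
    funext k
    refine ConcreteCategory.hom_ext _ _ fun x ↦ ?_
    have h1 := hl k ⟨SSet.ι₀.app k x, Or.inl ⟨x, rfl⟩⟩
    refine h1.trans ?_
    obtain h | ⟨y, hy, h⟩ := ht k ⟨SSet.ι₀.app k x, Or.inl ⟨x, rfl⟩⟩
    · exact congrArg Prod.fst h
    · exact (h01 _ _ _ hy.symm).elim
  · apply NatTrans.ext
    funext k
    refine ConcreteCategory.hom_ext _ _ fun x ↦ ?_
    have h1 := hl k ⟨SSet.ι₁.app k x, Or.inr ⟨x, rfl⟩⟩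
    refine h1.trans ?_
    obtain h | ⟨y, hy, h⟩ := ht k ⟨SSet.ι₁.app k x, Or.inr ⟨x, rfl⟩⟩
    · exact (h01 _ _ _ h).elim
    · have : y = x := congrArg Prod.fst hy
      rw [h, this]
      rfl

/-! ### The collage of the comma categories and the simplices -/

section

variable {D : Type} [SmallCategory D]

/-- The objects over `d` and the vertices of `i d`. -/
inductive Collage (i : D ⥤ SimplexCategory) (d : D) : Type u
  /-- an object over `d` -/
  | arr {e : D} (α : e ⟶ d) : Collage i d
  /-- a vertex of `i d` -/
  | pt (k : Fin ((i.obj d).len + 1)) : Collage i d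

namespace Collage

variable {i : D ⥤ SimplexCategory} {d : D}

/-- The zeroth vertex of the image. -/
def zeroth (X : Collage.{u} i d) : Fin ((i.obj d).len + 1) :=
  match X with
  | arr α => (i.map α).toOrderHom 0
  | pt k => k

/-- The morphisms in the collage. -/
inductive Hom : Collage.{u} i d → Collage.{u} i d → Type u
  /-- a morphism between objects over `d`, in the opposite direction -/
  | arr {e e' : D} {α : e ⟶ d} {α' : e' ⟶ d} (g : e' ⟶ e) (h : g ≫ α = α') :
    Hom (arr α) (arr α')
  /-- a morphism to a vertex -/
  | pt {X : Collage.{u} i d} {k : Fin ((i.obj d).len + 1)} (h : X.zeroth ≤ k) : Hom X (pt k)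

lemma Hom.zeroth_le {X Y : Collage.{u} i d} (f : Hom X Y) : X.zeroth ≤ Y.zeroth := by
  cases f with
  | arr g h =>
    subst h
    change (i.map _).toOrderHom 0 ≤ (i.map _).toOrderHom 0
    rw [i.map_comp]
    exact (i.map _).toOrderHom.monotone (Fin.zero_le _)
  | pt h => exact h

/-- The identity morphisms in the collage. -/
def id (X : Collage.{u} i d) : Hom X X :=
  match X with
  | arr _ => .arr (𝟙 _) (Category.id_comp _)
  | pt _ => .pt le_rfl

/-- The composition in the collage. -/
def Hom.comp {X Y Z : Collage.{u} i d} (f : Hom X Y) (g : Hom Y Z) : Hom X Z :=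
  match f, g with
  | .arr g h, .arr g' h' => .arr (g' ≫ g) (by rw [Category.assoc, h, h'])
  | f, .pt h => .pt (f.zeroth_le.trans h)

instance : Category.{u} (Collage.{u} i d) where
  Hom := Hom
  id := id
  comp := Hom.comp
  id_comp {X Y} f := by
    cases f with
    | arr g h => simp [id, Hom.comp]
    | pt h => cases X <;> rfl
  comp_id {X Y} f := by
    cases f with
    | arr g h => simp [id, Hom.comp]
    | pt h => rfl
  assoc {X Y Z W} f g h := by
    cases h with
    | arr h₁ h₂ =>
      cases g with
      | arr g₁ g₂ => cases f with
        | arr f₁ f₂ => simp [Hom.comp]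
    | pt h₁ => cases g <;> cases f <;> rfl

instance (X : Collage.{u} i d) (k : Fin ((i.obj d).len + 1)) : Subsingleton (X ⟶ pt k) where
  allEq := by
    change ∀ f g : Hom X (pt k), f = g
    rintro (_ | _) (_ | _)
    rfl

/-- The functor from the category of objects over `d`. -/
def fromOver (i : D ⥤ SimplexCategory) (d : D) : (Over d)ᵒᵖ ⥤ Collage.{u} i d where
  obj α := arr α.unop.hom
  map f := Hom.arr f.unop.left (Over.w f.unop)
  map_id _ := rfl
  map_comp _ _ := rfl

/-- The functoriality of the collage, on objects. -/
def mapObj {d' : D} (f : d ⟶ d') (X : Collage.{u} i d) : Collage.{u} i d' :=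
  match X with
  | arr α => arr (α ≫ f)
  | pt k => pt ((i.map f).toOrderHom k)

lemma zeroth_mapObj {d' : D} (f : d ⟶ d') (X : Collage.{u} i d) :
    (mapObj f X).zeroth = (i.map f).toOrderHom X.zeroth := by
  cases X with
  | arr α =>
    change (i.map (α ≫ f)).toOrderHom 0 = _
    rw [i.map_comp]
    rfl
  | pt k => rfl

/-- The functoriality of the collage, on morphisms. -/
def mapHom {d' : D} (f : d ⟶ d') {X Y : Collage.{u} i d} (g : Hom X Y) :
    Hom (mapObj f X) (mapObj f Y) :=
  match g with
  | .arr g h => .arr g (by rw [← h, Category.assoc])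
  | .pt h => .pt (by
      rw [zeroth_mapObj]
      exact (i.map f).toOrderHom.monotone h)

/-- The functoriality of the collage. -/
def map {d' : D} (f : d ⟶ d') : Collage.{u} i d ⥤ Collage.{u} i d' where
  obj := mapObj f
  map g := mapHom f g
  map_id X := by cases X <;> rfl
  map_comp {X Y Z} f g := by
    change Hom _ _ at f g
    cases g with
    | arr _ _ => cases f; rfl
    | pt _ => cases f <;> rfl

lemma heq_arr {e e' : D} {α β : e ⟶ d} {α' β' : e' ⟶ d} (hα : α = β) (hα' : α' = β')
    (g : e' ⟶ e) (h : g ≫ α = α') (h' : g ≫ β = β') :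
    HEq (Hom.arr.{u} (i := i) g h) (Hom.arr.{u} (i := i) g h') := by
  subst hα hα'
  rfl

lemma heq_pt {X Y : Collage.{u} i d} {k l : Fin ((i.obj d).len + 1)} (hX : X = Y) (hk : k = l)
    (h : X.zeroth ≤ k) (h' : Y.zeroth ≤ l) : HEq (Hom.pt.{u} h) (Hom.pt.{u} h') := by
  subst hX hk
  rfl

lemma map_id' (d : D) : map (i := i) (𝟙 d) = 𝟭 (Collage.{u} i d) := by
  have h (X : Collage.{u} i d) : (map (𝟙 d)).obj X = X := by
    cases X with
    | arr α => exact congrArg arr (Category.comp_id α)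
    | pt k =>
      refine congrArg pt ?_
      rw [i.map_id]
      rfl
  refine Functor.hext h fun X Y f ↦ ?_
  change Hom _ _ at f
  cases f with
  | arr g h => exact heq_arr (Category.comp_id _) (Category.comp_id _) _ _ _
  | pt h₁ => exact heq_pt (h _) (by rw [i.map_id]; rfl) _ _

lemma map_comp' {d' d'' : D} (f : d ⟶ d') (f' : d' ⟶ d'') :
    map (i := i) (f ≫ f') = (map f ⋙ map f' : Collage.{u} i d ⥤ Collage.{u} i d'') := by
  have hk (k) : (i.map (f ≫ f')).toOrderHom k = (i.map f').toOrderHom ((i.map f).toOrderHom k) := by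
    rw [i.map_comp]
    rfl
  have h (X : Collage.{u} i d) : (map (f ≫ f')).obj X = (map f').obj ((map f).obj X) := by
    cases X with
    | arr α => exact congrArg arr (Category.assoc α f f').symm
    | pt k => exact congrArg pt (hk k)
  refine Functor.hext h fun X Y f ↦ ?_
  change Hom _ _ at f
  cases f with
  | arr g h => exact heq_arr (Category.assoc _ _ _).symm (Category.assoc _ _ _).symm _ _ _
  | pt h₁ => exact heq_pt (h _) (hk _) _ _

end Collage

end

/-! ### The nerves of the collages and their retraction onto the simplices -/

section

variable {D : Type} [SmallCategory D]

/-- The diagram of the nerves of the collages. -/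
def collageNerve (i : D ⥤ SimplexCategory) : D ⥤ SSet.{u} where
  obj d := nerve (Collage i d)
  map f := nerveMap (Collage.map f)
  map_id d := by
    rw [Collage.map_id']
    rfl
  map_comp f g := by
    rw [Collage.map_comp']
    rfl

/-- The inclusion of the nerves of the comma categories. -/
def overNerveToCollage (i : D ⥤ SimplexCategory) : overNerve.{u} D ⟶ collageNerve i where
  app d :=
    { app _ := ↾fun x ↦ (x.down ⋙ Collage.fromOver i d :)
      naturality _ _ _ := rfl }
  naturality _ _ _ := rfl

/-- The inclusion of the simplices. -/
def stdSimplexToCollage (i : D ⥤ SimplexCategory) :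
    i ⋙ SSet.stdSimplex.{u} ⟶ collageNerve i where
  app _ :=
    { app _ := ↾fun x ↦
        { obj a := .pt ((SSet.stdSimplex.objEquiv x).toOrderHom a)
          map h := Collage.Hom.pt ((SSet.stdSimplex.objEquiv x).toOrderHom.monotone (leOfHom h))
          map_id _ := rfl
          map_comp _ _ := rfl }
      naturality _ _ _ := rfl }
  naturality _ _ _ := rfl

/-- The retraction of the collage onto the simplex, given by the zeroth vertices. -/
def collageToStdSimplex (i : D ⥤ SimplexCategory) :
    collageNerve.{u} i ⟶ i ⋙ SSet.stdSimplex.{u} where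
  app d :=
    { app k := ↾fun x ↦ SSet.stdSimplex.objMk
        { toFun a := (x.obj a).zeroth
          monotone' _ _ h := (x.map (homOfLE h)).zeroth_le }
      naturality _ _ _ := rfl }
  naturality d d' f := by
    apply NatTrans.ext
    funext k
    refine ConcreteCategory.hom_ext _ _ fun c ↦ ?_
    apply SSet.stdSimplex.objEquiv.injective
    apply SimplexCategory.Hom.ext
    apply OrderHom.ext
    funext j
    exact Collage.zeroth_mapObj _ _

lemma overNerveToCollage_comp (i : D ⥤ SimplexCategory) :
    overNerveToCollage.{u} i ≫ collageToStdSimplex i = zerothVertex i := rfl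

lemma stdSimplexToCollage_comp (i : D ⥤ SimplexCategory) :
    stdSimplexToCollage.{u} i ≫ collageToStdSimplex i = 𝟙 _ := by
  apply NatTrans.ext
  funext d
  apply NatTrans.ext
  funext k
  refine ConcreteCategory.hom_ext _ _ fun x ↦ ?_
  apply SSet.stdSimplex.objEquiv.injective
  apply SimplexCategory.Hom.ext
  apply OrderHom.ext
  rfl

/-! ### The deformation along the morphisms from an object to its zeroth vertex -/

namespace Collage

variable {i : D ⥤ SimplexCategory} {d : D}

/-- The objects of the deformation of the collage to the simplex. -/
def deform (X : Collage.{u} i d) (t : Fin 2) : Collage.{u} i d :=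
  match t with
  | 0 => X
  | 1 => pt X.zeroth

/-- The morphisms of the deformation of the collage to the simplex. -/
def Hom.deform {X Y : Collage.{u} i d} (f : Hom X Y) {t t' : Fin 2} (h : t ≤ t') :
    Hom (X.deform t) (Y.deform t') :=
  match t, t', h with
  | 0, 0, _ => f
  | 0, 1, _ => .pt f.zeroth_le
  | 1, 1, _ => .pt f.zeroth_le

lemma deform_id (X : Collage.{u} i d) {t : Fin 2} (h : t ≤ t) :
    Hom.deform (Collage.id X) h = Collage.id (X.deform t) := by
  match t with
  | 0 => rfl
  | 1 => rfl

lemma deform_comp {X Y Z : Collage.{u} i d} (f : Hom X Y) (g : Hom Y Z) {t t' t'' : Fin 2}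
    (h : t ≤ t') (h' : t' ≤ t'') :
    Hom.deform (f.comp g) (h.trans h') = (f.deform h).comp (g.deform h') := by
  match t, t', t'', h, h' with
  | 0, 0, 0, _, _ => rfl
  | 0, 0, 1, _, _ => cases f <;> rfl
  | 0, 1, 1, _, _ => cases f <;> rfl
  | 1, 1, 1, _, _ => rfl

lemma mapObj_deform {d' : D} (f : d ⟶ d') (X : Collage.{u} i d) (t : Fin 2) :
    mapObj f (X.deform t) = (mapObj f X).deform t := by
  match t with
  | 0 => rfl
  | 1 => exact congrArg pt (zeroth_mapObj f X).symm

lemma heq_mapHom_deform {d' : D} (f : d ⟶ d') {X Y : Collage.{u} i d} (g : Hom X Y)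
    {t t' : Fin 2} (h : t ≤ t') : HEq (mapHom f (g.deform h)) ((mapHom f g).deform h) := by
  match t, t', h with
  | 0, 0, _ => rfl
  | 0, 1, _ => exact heq_pt rfl (zeroth_mapObj f Y).symm _ _
  | 1, 1, _ => exact heq_pt (congrArg pt (zeroth_mapObj f X).symm) (zeroth_mapObj f Y).symm _ _

end Collage

/-- The deformation of the nerve of the collage to the simplex. -/
def collageDeformation (i : D ⥤ SimplexCategory) :
    collageNerve.{u} i ⋙ tensorRight Δ[1] ⟶ collageNerve i where
  app d :=
    { app _ := ↾fun x ↦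
        { obj a := Collage.deform (x.1.obj a) ((SSet.stdSimplex.objEquiv x.2).toOrderHom a)
          map h := Collage.Hom.deform (x.1.map h)
            ((SSet.stdSimplex.objEquiv x.2).toOrderHom.monotone (leOfHom h))
          map_id a := by
            have h := x.1.map_id a
            rw [h]
            exact Collage.deform_id _ _
          map_comp f g := by
            have h := x.1.map_comp f g
            rw [h]
            exact Collage.deform_comp _ _ _ _ }
      naturality _ _ _ := rfl }
  naturality d d' f := by
    apply NatTrans.ext
    funext k
    refine ConcreteCategory.hom_ext _ _ fun x ↦ ?_
    refine Functor.hext (fun a ↦ ?_) (fun a b h ↦ ?_)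
    · exact (Collage.mapObj_deform _ _ _).symm
    · exact (Collage.heq_mapHom_deform _ _ _).symm

lemma collageDeformation_zero (i : D ⥤ SimplexCategory) (d : D) :
    SSet.ι₀ ≫ (collageDeformation.{u} i).app d = 𝟙 _ := rfl

lemma collageDeformation_one (i : D ⥤ SimplexCategory) (d : D) :
    SSet.ι₁ ≫ (collageDeformation.{u} i).app d =
      (collageToStdSimplex i ≫ stdSimplexToCollage i).app d := rfl

end

/-! ### The Reedy structure of the nerves of the collages -/

lemma composableArrows_comp_injective {A B : Type*} [Category* A] [Category* B]
    (F : A ⥤ B) [F.Faithful] (hF : Function.Injective F.obj) {n : ℕ} {x y : ComposableArrows A n}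
    (h : x ⋙ F = y ⋙ F) : x = y := by
  have hobj (a) : x.obj a = y.obj a := hF (congrArg (fun z : ComposableArrows B n ↦ z.obj a) h)
  refine CategoryTheory.Functor.ext hobj fun a b f ↦ F.map_injective ?_
  rw [F.map_comp, F.map_comp, eqToHom_map, eqToHom_map]
  exact Functor.congr_hom h f

lemma exists_composableArrows_comp_eq {A B : Type*} [Category* A] [Category* B]
    (F : A ⥤ B) [F.Full] [F.Faithful] {n : ℕ} (y : ComposableArrows B n)
    (h : ∀ a, ∃ X, F.obj X = y.obj a) : ∃ x : ComposableArrows A n, x ⋙ F = y := by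
  choose X hX using h
  refine ⟨{
    obj := X
    map f := F.preimage (eqToHom (hX _) ≫ y.map f ≫ eqToHom (hX _).symm)
    map_id _ := F.map_injective (by simp)
    map_comp _ _ := F.map_injective (by simp) }, CategoryTheory.Functor.ext hX ?_⟩
  intro a b f
  simp

section

variable {D : Type} [SmallCategory D] {i : D ⥤ SimplexCategory}

namespace IsInitialSegment

variable (hi : IsInitialSegment i)

include hi

lemma mono_of_mono_map {e d : D} (m : e ⟶ d) (hm : Mono (i.map m)) : Mono m :=
  have := hi.faithful
  i.mono_of_mono_map hm

/-- A monotone injection reflects the order, so the pointwise preimages form a monotone map. -/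
lemma exists_lift {e d e' : D} (m : e ⟶ d) [Mono (i.map m)] (f : e' ⟶ d)
    (h : Set.range (i.map f).toOrderHom ⊆ Set.range (i.map m).toOrderHom) : ∃ g, g ≫ m = f := by
  have := hi.full
  have := hi.faithful
  have hm : Function.Injective (i.map m).toOrderHom :=
    SimplexCategory.mono_iff_injective.1 inferInstance
  choose φ hφ using fun a ↦ h ⟨a, rfl⟩
  refine ⟨i.preimage (SimplexCategory.Hom.mk ⟨φ, fun a b hab ↦ ?_⟩), i.map_injective ?_⟩
  · rw [← ((i.map m).toOrderHom.monotone.strictMono_of_injective hm).le_iff_le, hφ, hφ]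
    exact (i.map f).toOrderHom.monotone hab
  · rw [i.map_comp, i.map_preimage]
    apply SimplexCategory.Hom.ext
    apply OrderHom.ext
    funext a
    exact hφ a

/-- Enumerate `T` in increasing order; its size is bounded by that of `[i d]`, so the corresponding
ordinal is in the initial segment up to isomorphism. -/
lemma exists_mono (d : D) (T : Set (Fin ((i.obj d).len + 1))) (hT : T.Nonempty) :
    ∃ (e : D) (m : e ⟶ d), Mono (i.map m) ∧ Set.range (i.map m).toOrderHom = T := by
  classical
  have := hi.full
  have hcard : T.toFinset.card ≠ 0 := by
    rw [Finset.card_ne_zero]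
    simpa using hT
  obtain ⟨n, hn⟩ := Nat.exists_eq_succ_of_ne_zero hcard
  have hle : n ≤ (i.obj d).len := by
    have := Finset.card_le_univ T.toFinset
    rw [Fintype.card_fin] at this
    omega
  obtain ⟨e, ⟨iso⟩⟩ := hi.exists_iso d ⦋n⦌ hle
  let φ : ⦋n⦌ ⟶ i.obj d := SimplexCategory.Hom.mk
    (T.toFinset.orderEmbOfFin hn : Fin (n + 1) ↪o Fin ((i.obj d).len + 1)).toOrderHom
  have hφ : Mono φ := SimplexCategory.mono_iff_injective.2
    (T.toFinset.orderEmbOfFin hn).injective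
  have hφ' : Set.range φ.toOrderHom = T :=
    (Finset.range_orderEmbOfFin T.toFinset hn).trans (by simp)
  refine ⟨e, i.preimage (iso.hom ≫ φ), ?_, ?_⟩
  · rw [i.map_preimage]
    exact mono_comp _ _
  · rw [i.map_preimage, ← hφ']
    refine Set.Subset.antisymm ?_ ?_
    · rintro _ ⟨a, rfl⟩
      exact ⟨_, rfl⟩
    · rintro _ ⟨a, rfl⟩
      refine ⟨iso.inv.toOrderHom a, ?_⟩
      change (iso.inv ≫ iso.hom ≫ φ).toOrderHom a = _
      rw [Iso.inv_hom_id_assoc]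

/-- Each mono lifts through the other, so both sources have the same degree, and a mono between
objects of equal degree is an identity. -/
lemma eq_of_range_eq {e d e' : D} (m : e ⟶ d) [Mono (i.map m)] (m' : e' ⟶ d) [Mono (i.map m')]
    (h : Set.range (i.map m).toOrderHom = Set.range (i.map m').toOrderHom) :
    ∃ h : e = e', m = eqToHom h ≫ m' := by
  obtain ⟨g, rfl⟩ := hi.exists_lift m' m h.subset
  obtain ⟨g', hg'⟩ := hi.exists_lift (g ≫ m') m' h.symm.subset
  have : Mono (i.map g) := by
    have h : Mono (i.map (g ≫ m')) := inferInstance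
    rw [i.map_comp] at h
    exact mono_of_mono _ (i.map m')
  have : Mono (i.map g') := by
    have h : Mono (i.map m') := inferInstance
    rw [← hg', i.map_comp] at h
    exact mono_of_mono _ (i.map (g ≫ m'))
  obtain ⟨rfl, rfl⟩ := hi.eq_of_mono g (SimplexCategory.len_le_of_mono (i.map g'))
  exact ⟨rfl, rfl⟩

/-- The images in the collage. -/
def imageStructure (d : D) : ImageStructure (Collage.{u} i d) (Fin ((i.obj d).len + 1)) where
  im X := match X with
    | .arr α => Set.range (i.map α).toOrderHom
    | .pt k => {k}
  IsPt X := match X with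
    | .arr α => False
    | .pt k => True
  IsSub X := match X with
    | .arr α => Mono (i.map α)
    | .pt k => False
  im_subset {X Y} f hY := by
    change Collage.Hom X Y at f
    cases f with
    | arr g h =>
      subst h
      rintro _ ⟨a, rfl⟩
      refine ⟨(i.map g).toOrderHom a, ?_⟩
      rw [i.map_comp]
      rfl
    | pt h => exact (hY trivial).elim
  subsingleton_hom {X} hX Y := by
    cases Y with
    | pt k => infer_instance
    | arr α =>
      constructor
      change ∀ f g : Collage.Hom X (.arr α), f = g
      intro f g
      cases f with
      | arr f hf =>
        cases g with
        | arr g hg =>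
          have := hi.mono_of_mono_map _ hX
          obtain rfl : f = g := (cancel_mono _).1 (hf.trans hg.symm)
          rfl
  nonempty_hom {X} hX Y h := by
    cases X with
    | pt k => exact hX.elim
    | arr α =>
      cases Y with
      | pt k =>
        obtain ⟨a, ha⟩ := h rfl
        refine ⟨Collage.Hom.pt ?_⟩
        rw [← ha]
        exact (i.map α).toOrderHom.monotone (Fin.zero_le _)
      | arr β =>
        have : Mono (i.map α) := hX
        obtain ⟨g, hg⟩ := hi.exists_lift α β h
        exact ⟨Collage.Hom.arr g hg⟩
  ext {X Y} hX hY h := by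
    cases X with
    | pt k => exact hX.elim
    | arr α =>
      cases Y with
      | pt k => exact hY.elim
      | arr β =>
        have : Mono (i.map α) := hX
        have : Mono (i.map β) := hY
        obtain ⟨rfl, rfl⟩ := hi.eq_of_range_eq α β h
        exact congrArg Collage.arr (Category.id_comp β)
  exists_sub Y T h := by
    obtain ⟨e, m, hm, hT⟩ := hi.exists_mono d T (Set.Nonempty.mono h (by
      cases Y with
      | arr α => exact ⟨_, 0, rfl⟩
      | pt k => exact ⟨k, rfl⟩))
    exact ⟨.arr m, hm, hT⟩
  not_isPt {X} hX := by
    cases X with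
    | arr α => exact fun h ↦ h
    | pt k => exact hX.elim

end IsInitialSegment

end

/-! ### Faces and latching subcomplexes of the collage nerves -/

section

variable {D : Type} [SmallCategory D] {i : D ⥤ SimplexCategory}

namespace Collage

instance (d : D) : (fromOver.{u} i d).Faithful where
  map_injective {X Y} f g h := by
    apply Quiver.Hom.unop_inj
    apply Over.OverMorphism.ext
    change Hom.arr _ _ = Hom.arr _ _ at h
    exact Hom.arr.inj h

instance (d : D) : (fromOver.{u} i d).Full where
  map_surjective {X Y} f := by
    change Hom (arr X.unop.hom) (arr Y.unop.hom) at f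
    cases f with
    | arr g h => exact ⟨(Over.homMk g h).op, rfl⟩

lemma fromOver_obj_injective (d : D) : Function.Injective (fromOver.{u} i d).obj := by
  intro X Y h
  obtain ⟨h₁, h₂⟩ := arr.inj h
  apply Opposite.unop_injective
  generalize X.unop = X at *
  generalize Y.unop = Y at *
  obtain ⟨X, ⟨⟨⟩⟩, f⟩ := X
  obtain ⟨Y, ⟨⟨⟩⟩, g⟩ := Y
  change X = Y at h₁
  subst h₁
  obtain rfl := eq_of_heq h₂
  rfl

lemma overNerveToCollage_app_injective (d : D) (k) :
    Function.Injective (((overNerveToCollage.{u} i).app d).app k) := by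
  rintro ⟨x⟩ ⟨y⟩ h
  exact congrArg ULift.up (composableArrows_comp_injective (n := k.unop.len) (fromOver.{u} i d)
    (fromOver_obj_injective d) h)

lemma mem_range_overNerveToCollage_iff {d : D} {k} (x : ((collageNerve.{u} i).obj d).obj k) :
    x ∈ (SSet.Subcomplex.range ((overNerveToCollage i).app d)).obj k ↔
      ∀ a, ∃ (e : D) (α : e ⟶ d), x.obj a = .arr α := by
  constructor
  · rintro ⟨y, rfl⟩ a
    exact ⟨_, _, rfl⟩
  · intro h
    obtain ⟨y, hy⟩ := exists_composableArrows_comp_eq (n := k.unop.len) (fromOver.{u} i d) x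
      fun a ↦ by
        obtain ⟨e, α, hα⟩ := h a
        exact ⟨op (Over.mk α), hα.symm⟩
    exact ⟨⟨y⟩, hy⟩

instance {e d : D} (m : e ⟶ d) : (map.{u} (i := i) m).Faithful where
  map_injective {X Y} f g h := by
    change Hom X Y at f g
    cases f with
    | pt _ => exact Subsingleton.elim (α := X ⟶ pt _) _ _
    | arr f hf =>
      cases g with
      | arr g hg =>
        obtain rfl : f = g := by
          change Hom.arr f _ = Hom.arr g _ at h
          exact Hom.arr.inj h
        rfl

end Collage

namespace IsInitialSegment

variable (hi : IsInitialSegment i)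

include hi

lemma mapObj_injective {e d : D} (m : e ⟶ d) [Mono (i.map m)] :
    Function.Injective (Collage.map.{u} (i := i) m).obj := by
  have := hi.mono_of_mono_map m inferInstance
  intro X Y h
  cases X with
  | arr α =>
    cases Y with
    | arr β =>
      obtain ⟨rfl, h⟩ := Collage.arr.inj h
      rw [heq_eq_eq, cancel_mono] at h
      rw [h]
    | pt l => cases h
  | pt k =>
    cases Y with
    | arr β => cases h
    | pt l =>
      exact congrArg Collage.pt (SimplexCategory.mono_iff_injective.1
        (inferInstance : Mono (i.map m)) (Collage.pt.inj h))

lemma full_map {e d : D} (m : e ⟶ d) [Mono (i.map m)] :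
    (Collage.map.{u} (i := i) m).Full where
  map_surjective {X Y} f := by
    have := hi.mono_of_mono_map m inferInstance
    cases Y with
    | pt k =>
      refine ⟨Collage.Hom.pt ?_, Subsingleton.elim (α := _ ⟶ Collage.pt _) _ _⟩
      have h := Collage.Hom.zeroth_le f
      have hm : Function.Injective (i.map m).toOrderHom :=
        SimplexCategory.mono_iff_injective.1 inferInstance
      rw [← ((i.map m).toOrderHom.monotone.strictMono_of_injective hm).le_iff_le]
      exact (Collage.zeroth_mapObj m X).symm.le.trans h
    | arr β =>
      cases X with
      | pt k =>
        change Collage.Hom (Collage.pt _) (Collage.arr _) at f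
        cases f
      | arr α =>
        change Collage.Hom (Collage.arr (α ≫ m)) (Collage.arr (β ≫ m)) at f
        cases f with
        | arr g h =>
          rw [← Category.assoc, cancel_mono] at h
          exact ⟨Collage.Hom.arr g h, rfl⟩

lemma exists_mapObj_eq {e d : D} (m : e ⟶ d) [Mono (i.map m)] (X : Collage.{u} i d)
    (hX : (hi.imageStructure d).im X ⊆ Set.range (i.map m).toOrderHom) :
    ∃ Y, (Collage.map m).obj Y = X := by
  cases X with
  | arr α =>
    obtain ⟨g, rfl⟩ := hi.exists_lift m α hX
    exact ⟨.arr g, rfl⟩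
  | pt k =>
    obtain ⟨l, rfl⟩ := hX rfl
    exact ⟨.pt l, rfl⟩

lemma im_mapObj_subset {e d : D} (m : e ⟶ d) (Y : Collage.{u} i e) :
    (hi.imageStructure d).im ((Collage.map m).obj Y) ⊆ Set.range (i.map m).toOrderHom := by
  cases Y with
  | arr α =>
    rintro _ ⟨a, rfl⟩
    refine ⟨(i.map α).toOrderHom a, ?_⟩
    rw [i.map_comp]
    rfl
  | pt k =>
    rintro _ rfl
    exact ⟨k, rfl⟩

lemma collageNerve_map_injective {e d : D} (m : e ⟶ d) [Mono (i.map m)] (k) :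
    Function.Injective (((collageNerve.{u} i).map m).app k) := by
  intro x y h
  exact composableArrows_comp_injective _ (hi.mapObj_injective m) h

/-- The collage of `e` embeds in that of `d` as the full subcategory of the objects whose image lies
in the image of `m`, and the first support of a chain contains the images of all its objects. -/
lemma exists_collageNerve_map_eq_iff {e d : D} (m : e ⟶ d) [Mono (i.map m)] {k}
    (x : ((collageNerve.{u} i).obj d).obj k) :
    (∃ y, ((collageNerve.{u} i).map m).app k y = x) ↔
      (hi.imageStructure d).supp (n := k.unop.len) x 0 ⊆ Set.range (i.map m).toOrderHom := by
  constructor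
  · rintro ⟨y, rfl⟩
    refine Set.union_subset (hi.im_mapObj_subset m _) ?_
    rintro v ⟨a, -, ha⟩
    exact hi.im_mapObj_subset m _ ha
  · intro h
    have := hi.full_map.{u} m
    refine exists_composableArrows_comp_eq (Collage.map m) (n := k.unop.len) x fun a ↦
      hi.exists_mapObj_eq m _ ?_
    exact Set.subset_union_left.trans
      (((hi.imageStructure d).supp_subset (n := k.unop.len) x (Fin.zero_le a)).trans h)

lemma supp_nonempty {d : D} {k} (x : ((collageNerve.{u} i).obj d).obj k) :
    ((hi.imageStructure d).supp (n := k.unop.len) x 0).Nonempty := by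
  refine Set.Nonempty.mono Set.subset_union_left ?_
  generalize x.obj 0 = X
  cases X with
  | arr α => exact ⟨_, 0, rfl⟩
  | pt k => exact ⟨k, rfl⟩

/-- The smallest face containing a chain is the one spanned by its support. -/
lemma hasMinimalSimplices_collageNerve : HasMinimalSimplices i (collageNerve.{u} i) := by
  intro d k x
  obtain ⟨e₀, m₀, hm₀, h⟩ := hi.exists_mono d _ (hi.supp_nonempty x)
  obtain ⟨x₀, rfl⟩ := (hi.exists_collageNerve_map_eq_iff m₀ x).2 h.symm.subset
  refine ⟨e₀, m₀, x₀, hm₀, rfl, fun e m y hm hy ↦ ?_⟩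
  obtain ⟨n, rfl⟩ := hi.exists_lift m m₀ (by
    rw [h]
    exact (hi.exists_collageNerve_map_eq_iff m _).1 ⟨y, hy⟩)
  refine ⟨n, rfl, hi.collageNerve_map_injective m k ?_⟩
  rw [hy, map_comp_app_apply]

lemma latching_imageStructure (d : D) :
    (hi.imageStructure.{u} d).latching = SSet.Subcomplex.range ((overNerveToCollage i).app d) ⊔
      latchingSubcomplex i (collageNerve i) d := by
  ext k x
  refine or_congr ?_ ?_
  · refine Iff.trans ?_ (Collage.mem_range_overNerveToCollage_iff x).symm
    rw [Set.eq_empty_iff_forall_notMem]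
    constructor
    · intro h a
      generalize hX : x.obj a = X
      cases X with
      | arr α => exact ⟨_, _, rfl⟩
      | pt v =>
        refine (h v ⟨a, ?_⟩).elim
        rw [hX]
        exact ⟨trivial, rfl⟩
    · rintro h v ⟨a, ha, -⟩
      obtain ⟨e, α, hα⟩ := h a
      rw [hα] at ha
      exact ha
  · constructor
    · intro h
      obtain ⟨e, m, hm, he⟩ := hi.exists_mono d _ (hi.supp_nonempty x)
      obtain ⟨y, hy⟩ := (hi.exists_collageNerve_map_eq_iff m x).2 he.symm.subset
      refine ⟨e, m, ?_, hm, y, hy⟩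
      by_contra hlt
      -- If the face spanned by the support were not proper, `m` would be an identity and the
      -- support everything.
      obtain ⟨rfl, rfl⟩ := hi.eq_of_mono m (not_lt.1 hlt)
      refine h (he.symm.trans ?_)
      rw [eqToHom_refl, i.map_id]
      exact Set.range_id
    · rintro ⟨e, m, hlt, hm, y, hy⟩ h
      have := (hi.exists_collageNerve_map_eq_iff m x).1 ⟨y, hy⟩
      rw [h, Set.univ_subset_iff, Set.range_eq_univ] at this
      have : Epi (i.map m) := SimplexCategory.epi_iff_surjective.2 this
      have := SimplexCategory.len_le_of_epi (i.map m)
      omega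

end IsInitialSegment

end

/-! ### Maps to mapping spaces -/

section

variable {D : Type} [SmallCategory D] {A B : D ⥤ SSet.{u}} {L : SSet.{u}}

/-- The value of a natural transformation `A × L ⟶ B` at a pair of simplices. -/
def tensorApply (Φ : A ⋙ tensorRight L ⟶ B) {d : D} {m : SimplexCategoryᵒᵖ}
    (a : (A.obj d).obj m) (l : L.obj m) : (B.obj d).obj m :=
  (Φ.app d : A.obj d ⊗ L ⟶ B.obj d).app m (a, l)

lemma map_tensorApply (Φ : A ⋙ tensorRight L ⟶ B) {d : D} {m m' : SimplexCategoryᵒᵖ}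
    (θ : m ⟶ m') (a : (A.obj d).obj m) (l : L.obj m) :
    (B.obj d).map θ (tensorApply Φ a l) = tensorApply Φ ((A.obj d).map θ a) (L.map θ l) :=
  (ConcreteCategory.congr_hom ((Φ.app d).naturality θ) ((a, l) : (A.obj d ⊗ L).obj m)).symm

lemma map_app_tensorApply (Φ : A ⋙ tensorRight L ⟶ B) {d d' : D} (f : d ⟶ d')
    {m : SimplexCategoryᵒᵖ} (a : (A.obj d).obj m) (l : L.obj m) :
    (B.map f).app m (tensorApply Φ a l) = tensorApply Φ ((A.map f).app m a) l :=
  (ConcreteCategory.congr_hom (NatTrans.congr_app (Φ.naturality f) m)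
    ((a, l) : (A.obj d ⊗ L).obj m)).symm

/-- Constructor for natural transformations `A × L ⟶ B`. -/
def tensorHomMk (φ : ∀ (d : D) (m : SimplexCategoryᵒᵖ), (A.obj d).obj m → L.obj m → (B.obj d).obj m)
    (h₁ : ∀ d m m' (θ : m ⟶ m') a l,
      (B.obj d).map θ (φ d m a l) = φ d m' ((A.obj d).map θ a) (L.map θ l))
    (h₂ : ∀ d d' (f : d ⟶ d') m a l, (B.map f).app m (φ d m a l) = φ d' m ((A.map f).app m a) l) :
    A ⋙ tensorRight L ⟶ B where
  app d :=
    { app m := ↾fun x ↦ φ d m x.1 x.2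
      naturality _ _ θ := ConcreteCategory.hom_ext _ _ fun x ↦ (h₁ _ _ _ θ x.1 x.2).symm }
  naturality _ _ f := by
    apply NatTrans.ext
    funext k
    exact ConcreteCategory.hom_ext _ _ fun x ↦ (h₂ _ _ f k x.1 x.2).symm

lemma tensorHom_ext {Φ Φ' : A ⋙ tensorRight L ⟶ B}
    (h : ∀ d m (a : (A.obj d).obj m) (l : L.obj m), tensorApply Φ a l = tensorApply Φ' a l) :
    Φ = Φ' := by
  apply NatTrans.ext
  funext d
  apply NatTrans.ext
  funext m
  exact ConcreteCategory.hom_ext _ _ fun x ↦ h d m x.1 x.2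

/-- The value of a map `L ⟶ hom(A, B)` at a pair of simplices. -/
def mapSpaceApply (f : L ⟶ mapSpace A B) {d : D} {m : SimplexCategoryᵒᵖ} (a : (A.obj d).obj m)
    (l : L.obj m) : (B.obj d).obj m :=
  tensorApply (A := A) (f.app m l) a (SSet.stdSimplex.objEquiv.symm (𝟙 m.unop))

/-- Yoneda: evaluating `f l` at a simplex `θ` is evaluating `f (θ^* l)` at the top simplex, so
`mapSpaceApply` loses no information. -/
lemma mapSpaceApply_map (f : L ⟶ mapSpace A B) {d : D} {m m' : SimplexCategoryᵒᵖ} (θ : m ⟶ m')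
    (a : (A.obj d).obj m') (l : L.obj m) :
    mapSpaceApply f a (L.map θ l) =
      tensorApply (A := A) (f.app m l) a (SSet.stdSimplex.objEquiv.symm θ.unop) := by
  unfold mapSpaceApply
  rw [NatTrans.naturality_apply]
  have h := Category.id_comp θ.unop
  exact congrArg (fun t ↦ tensorApply (A := A) (f.app m l) a (SSet.stdSimplex.objEquiv.symm t)) h

lemma map_mapSpaceApply (f : L ⟶ mapSpace A B) {d : D} {m m' : SimplexCategoryᵒᵖ}
    (θ : m ⟶ m') (a : (A.obj d).obj m) (l : L.obj m) :
    (B.obj d).map θ (mapSpaceApply f a l) = mapSpaceApply f ((A.obj d).map θ a) (L.map θ l) := by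
  rw [mapSpaceApply_map]
  refine (map_tensorApply _ _ _ _).trans ?_
  have h := Category.comp_id θ.unop
  exact congrArg (fun t ↦ tensorApply (A := A) (f.app m l) ((A.obj d).map θ a)
    (SSet.stdSimplex.objEquiv.symm t)) h

lemma map_app_mapSpaceApply (f : L ⟶ mapSpace A B) {d d' : D} (g : d ⟶ d')
    {m : SimplexCategoryᵒᵖ} (a : (A.obj d).obj m) (l : L.obj m) :
    (B.map g).app m (mapSpaceApply f a l) = mapSpaceApply f ((A.map g).app m a) l :=
  map_app_tensorApply _ _ _ _

lemma mapSpace_hom_ext {f g : L ⟶ mapSpace A B}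
    (h : ∀ d m (a : (A.obj d).obj m) (l : L.obj m), mapSpaceApply f a l = mapSpaceApply g a l) :
    f = g := by
  apply NatTrans.ext
  funext k
  refine ConcreteCategory.hom_ext _ _ fun l ↦ tensorHom_ext fun d m a x ↦ ?_
  have h := h d m a (L.map (SSet.stdSimplex.objEquiv x).op l)
  rwa [mapSpaceApply_map, mapSpaceApply_map] at h

/-- The map `L ⟶ hom(A, B)` corresponding to a natural transformation `A × L ⟶ B`. -/
def mapSpaceCurry (Φ : A ⋙ tensorRight L ⟶ B) : L ⟶ mapSpace A B where
  app k := ↾fun l ↦ Functor.whiskerLeft A ((tensoringRight SSet.{u}).map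
    (SSet.yonedaEquiv.symm l)) ≫ Φ
  naturality k l θ := by
    refine ConcreteCategory.hom_ext _ _ fun x ↦ tensorHom_ext fun d m a y ↦ ?_
    exact congrArg (fun t ↦ tensorApply Φ a t)
      (ConcreteCategory.congr_hom (L.map_comp θ (SSet.stdSimplex.objEquiv y).op) x).symm

lemma mapSpaceApply_curry (Φ : A ⋙ tensorRight L ⟶ B) {d : D} {m : SimplexCategoryᵒᵖ}
    (a : (A.obj d).obj m) (l : L.obj m) :
    mapSpaceApply (mapSpaceCurry Φ) a l = tensorApply Φ a l :=
  congrArg (fun t ↦ tensorApply Φ a t) (ConcreteCategory.congr_hom (L.map_id m) l)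

/-- The homotopy sends `(φ, t)` to `x ↦ φ (H (x, t))`. -/
lemma directlyHomotopic_mapSpacePre {A' : D ⥤ SSet.{u}} {a a' : A' ⟶ A}
    (H : A' ⋙ tensorRight Δ[1] ⟶ A) (h₀ : ∀ d, SSet.ι₀ ≫ H.app d = a.app d)
    (h₁ : ∀ d, SSet.ι₁ ≫ H.app d = a'.app d) (B : D ⥤ SSet.{u}) :
    DirectlyHomotopic (mapSpacePre a B) (mapSpacePre a' B) := by
  refine ⟨mapSpaceCurry (tensorHomMk (fun d m x y ↦
    mapSpaceApply (𝟙 (mapSpace A B)) (tensorApply H x y.2) y.1) ?_ ?_), ?_, ?_⟩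
  · intro d m m' θ x y
    rw [map_mapSpaceApply, map_tensorApply]
    rfl
  · intro d d' f m x y
    rw [map_app_mapSpaceApply, map_app_tensorApply]
  · refine mapSpace_hom_ext fun d m x y ↦ (mapSpaceApply_curry _ _ _).trans ?_
    exact congrArg (fun t ↦ mapSpaceApply (𝟙 (mapSpace A B)) t y)
      (ConcreteCategory.congr_hom (NatTrans.congr_app (h₀ d) m) x)
  · refine mapSpace_hom_ext fun d m x y ↦ (mapSpaceApply_curry _ _ _).trans ?_
    exact congrArg (fun t ↦ mapSpaceApply (𝟙 (mapSpace A B)) t y)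
      (ConcreteCategory.congr_hom (NatTrans.congr_app (h₁ d) m) x)

lemma isWeakEquivalence_mapSpacePre_collageToStdSimplex (i : D ⥤ SimplexCategory)
    (B : D ⥤ SSet.{u}) : IsWeakEquivalence (mapSpacePre (collageToStdSimplex i) B) := by
  refine isWeakEquivalence_of_directlyHomotopic (g := mapSpacePre (stdSimplexToCollage i) B) ?_ ?_
  · have h : mapSpacePre (collageToStdSimplex i) B ≫ mapSpacePre (stdSimplexToCollage i) B =
        mapSpacePre (stdSimplexToCollage i ≫ collageToStdSimplex i) B := rfl
    rw [h, stdSimplexToCollage_comp]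
    exact .refl _
  · exact directlyHomotopic_mapSpacePre (a := 𝟙 _) (collageDeformation i) (collageDeformation_zero i)
      (collageDeformation_one i) B

end

/-! ### The zeroth vertex map induces weak equivalences -/

lemma mem_unionProd {X Y : SSet.{u}} {S : X.Subcomplex} {T : Y.Subcomplex} {n}
    {x : (X ⊗ Y).obj n} : x ∈ (S.unionProd T).obj n ↔ x.2 ∈ T.obj n ∨ x.1 ∈ S.obj n :=
  SSet.Subcomplex.mem_unionProd_iff _ _ _

lemma mapSpaceApply_comp {D : Type} [SmallCategory D] {A B : D ⥤ SSet.{u}} {L L' : SSet.{u}}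
    (g : L' ⟶ L) (f : L ⟶ mapSpace A B) {d : D} {m} (a : (A.obj d).obj m) (l : L'.obj m) :
    mapSpaceApply (g ≫ f) a l = mapSpaceApply f a (g.app m l) := rfl

lemma mapSpaceApply_pre {D : Type} [SmallCategory D] {A' A B : D ⥤ SSet.{u}} {L : SSet.{u}}
    (f : L ⟶ mapSpace A B) (j : A' ⟶ A) {d : D} {m} (a : (A'.obj d).obj m) (l : L.obj m) :
    mapSpaceApply (f ≫ mapSpacePre j B) a l = mapSpaceApply f ((j.app d).app m a) l := rfl

section

variable {D : Type} [SmallCategory D] {i : D ⥤ SimplexCategory}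

lemma Collage.exists_eq_arr_of_mapObj_eq_arr {d d' : D} (f : d ⟶ d') {X : Collage.{u} i d}
    {e : D} {α : e ⟶ d'} (h : mapObj f X = arr α) :
    ∃ (e : D) (β : e ⟶ d), X = arr β := by
  cases X with
  | arr β => exact ⟨_, _, rfl⟩
  | pt _ => cases h

lemma HasMinimalSimplices.tensorRight {P : D ⥤ SSet.{u}} (hP : HasMinimalSimplices i P)
    (L : SSet.{u}) : HasMinimalSimplices i (P ⋙ tensorRight L) := by
  intro d k x
  obtain ⟨e₀, m₀, x₀, hm₀, hx₀, h⟩ := hP d k (x : (P.obj d ⊗ L).obj k).1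
  refine ⟨e₀, m₀, ((x₀, (x : (P.obj d ⊗ L).obj k).2) : (P.obj e₀ ⊗ L).obj k), hm₀,
    Prod.ext hx₀ rfl, fun e m y hm hy ↦ ?_⟩
  obtain ⟨n, hn, hn'⟩ := h e m (y : (P.obj e ⊗ L).obj k).1 hm (congrArg Prod.fst hy)
  exact ⟨n, hn, Prod.ext hn' (congrArg Prod.snd hy).symm⟩

/-! ### Lifting problems as partially defined natural transformations -/

section

variable {N P R : D ⥤ SSet.{u}} (j : N ⟶ P)
  (hj : ∀ d k, Function.Injective ((j.app d).app k)) {L : SSet.{u}} (K : L.Subcomplex)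
  (t : (K : SSet.{u}) ⟶ mapSpace P R) (b : L ⟶ mapSpace N R)
  (sq : CommSq t K.ι (mapSpacePre j R) b)

/-- The values which are prescribed by a lifting problem. -/
def Prescribed (d : D) (k : SimplexCategoryᵒᵖ) (x : (P.obj d ⊗ L).obj k)
    (w : (R.obj d).obj k) : Prop :=
  (∃ h : x.2 ∈ K.obj k, w = mapSpaceApply t x.1 ⟨x.2, h⟩) ∨
    ∃ y, (j.app d).app k y = x.1 ∧ w = mapSpaceApply b y x.2

variable {j K t b}

include hj sq in
-- Commutativity of the square reconciles the two kinds of values; injectivity of `j` makes the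
-- second kind well defined.
lemma Prescribed.unique {d : D} {k : SimplexCategoryᵒᵖ} {x : (P.obj d ⊗ L).obj k}
    {w w' : (R.obj d).obj k} (h : Prescribed j K t b d k x w) (h' : Prescribed j K t b d k x w') :
    w = w' := by
  have key (h : x.2 ∈ K.obj k) (y) (hy : (j.app d).app k y = x.1) :
      mapSpaceApply t x.1 ⟨x.2, h⟩ = mapSpaceApply b y x.2 := by
    rw [← hy]
    refine (mapSpaceApply_pre t j y (⟨x.2, h⟩ : (K : SSet.{u}).obj k)).symm.trans ?_
    rw [sq.w]
    rfl
  obtain ⟨h, rfl⟩ | ⟨y, hy, rfl⟩ := h <;> obtain ⟨h', rfl⟩ | ⟨y', hy', rfl⟩ := h'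
  · rfl
  · exact key _ _ hy'
  · exact (key _ _ hy).symm
  · rw [hj d k (hy.trans hy'.symm)]

lemma Prescribed.map {d : D} {k l : SimplexCategoryᵒᵖ} (θ : k ⟶ l) {x : (P.obj d ⊗ L).obj k}
    {w : (R.obj d).obj k} (h : Prescribed j K t b d k x w) :
    Prescribed j K t b d l ((P.obj d ⊗ L).map θ x) ((R.obj d).map θ w) := by
  obtain ⟨h, rfl⟩ | ⟨y, hy, rfl⟩ := h
  · exact Or.inl ⟨K.map θ h, map_mapSpaceApply _ _ _ _⟩
  · refine Or.inr ⟨(N.obj d).map θ y, ?_, map_mapSpaceApply _ _ _ _⟩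
    rw [NatTrans.naturality_apply, hy]
    rfl

lemma Prescribed.map_app {d d' : D} (f : d ⟶ d') {k : SimplexCategoryᵒᵖ}
    {x : (P.obj d ⊗ L).obj k} {w : (R.obj d).obj k} (h : Prescribed j K t b d k x w) :
    Prescribed j K t b d' k ((P.map f ▷ L).app k x) ((R.map f).app k w) := by
  obtain ⟨h, rfl⟩ | ⟨y, hy, rfl⟩ := h
  · exact Or.inl ⟨h, map_app_mapSpaceApply _ _ _ _⟩
  · refine Or.inr ⟨(N.map f).app k y, ?_, map_app_mapSpaceApply _ _ _ _⟩
    have := ConcreteCategory.congr_hom (NatTrans.congr_app (j.naturality f) k) y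
    exact this.trans (congrArg ((P.map f).app k) hy)

include hj sq in
/-- The partially defined natural transformation given by a lifting problem. -/
lemma exists_partialHom : ∃ F : PartialHom (P ⋙ tensorRight L) R,
    (∀ d, F.Q d = (SSet.Subcomplex.range (j.app d)).unionProd K) ∧
      ∀ d k (x : (P.obj d ⊗ L).obj k) (hx : x ∈ (F.Q d).obj k),
        Prescribed j K t b d k x ((F.φ d).app k ⟨x, hx⟩) := by
  choose φ hφ using fun d ↦ exists_hom_of_rel ((SSet.Subcomplex.range (j.app d)).unionProd K)
    (Prescribed j K t b d) (by
      rintro k x hx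
      obtain hx | ⟨y, hy⟩ := mem_unionProd.1 hx
      · exact ⟨_, Or.inl ⟨hx, rfl⟩⟩
      · exact ⟨_, Or.inr ⟨y, hy, rfl⟩⟩)
    (fun k x w w' h h' ↦ h.unique hj sq h') (fun k l θ x w h ↦ h.map θ)
  have hle {d d' : D} (f : d ⟶ d') : (SSet.Subcomplex.range (j.app d)).unionProd K ≤
      ((SSet.Subcomplex.range (j.app d')).unionProd K).preimage (P.map f ▷ L) := by
    intro k x hx
    refine mem_unionProd.2 ?_
    obtain hx | ⟨y, hy⟩ := mem_unionProd.1 hx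
    · exact Or.inl hx
    · refine Or.inr ⟨(N.map f).app k y, ?_⟩
      have := ConcreteCategory.congr_hom (NatTrans.congr_app (j.naturality f) k) y
      exact this.trans (congrArg ((P.map f).app k) hy)
  exact ⟨
    { Q d := (SSet.Subcomplex.range (j.app d)).unionProd K
      le_preimage := hle
      φ := φ
      nat f k x hx := ((hφ _ k ⟨x, hx⟩).map_app f).unique hj sq (hφ _ k ⟨_, hle f k hx⟩) },
    fun _ ↦ rfl, fun d k x hx ↦ hφ d k ⟨x, hx⟩⟩

end

/-- Reedy trivial cofibrations induce trivial fibrations of mapping spaces. -/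
lemma hasLiftingProperty_mapSpacePre (hi : IsInitialSegment i) {Z : SimplexCategory ⥤ SSet.{u}}
    (hZ : IsFibrantCosimplicial Z) {L : SSet.{u}} (K : L.Subcomplex) :
    HasLiftingProperty K.ι (mapSpacePre (overNerveToCollage i) (i ⋙ Z)) where
  sq_hasLift {t b} sq := by
    -- By adjunction the square is a transformation defined on `N × L ∪ P × K`, and a lift is an
    -- extension of it to `P × L`.
    obtain ⟨F, hQ, hF⟩ := exists_partialHom Collage.overNerveToCollage_app_injective sq
    obtain ⟨Φ, hΦ⟩ := exists_extension F hi hZ (hi.hasMinimalSimplices_collageNerve.tensorRight L)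
      (by
        intro e d m hm k x hx
        rw [hQ] at hx ⊢
        refine mem_unionProd.2 ?_
        obtain hx | hx := mem_unionProd.1 hx
        · exact Or.inl hx
        · right
          rw [Collage.mem_range_overNerveToCollage_iff] at hx ⊢
          intro a
          obtain ⟨e', α, h⟩ := hx a
          exact Collage.exists_eq_arr_of_mapObj_eq_arr m h)
      (by
        intro d
        rw [hQ]
        -- The relative latching inclusion is the pushout-product of the one for the collage nerve
        -- with `K ⊆ L`, hence anodyne.
        have : (SSet.Subcomplex.range ((overNerveToCollage i).app d)).unionProd K ⊔
            latchingSubcomplex i (collageNerve.{u} i ⋙ tensorRight L) d =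
              (hi.imageStructure d).latching.unionProd K := by
          rw [hi.latching_imageStructure]
          ext k x
          refine Iff.trans ?_ mem_unionProd.symm
          constructor
          · rintro (h | ⟨e, m, he, hm, y, rfl⟩)
            · exact (mem_unionProd.1 h).imp id Or.inl
            · exact Or.inr (Or.inr ⟨e, m, he, hm, (y : (_ ⊗ L : SSet.{u}).obj k).1, rfl⟩)
          · rintro (h | h | ⟨e, m, he, hm, y, hy⟩)
            · exact Or.inl (mem_unionProd.2 (Or.inl h))
            · exact Or.inl (mem_unionProd.2 (Or.inr h))
            · exact Or.inr ⟨e, m, he, hm, ((y, x.2) : (_ ⊗ L : SSet.{u}).obj k),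
                Prod.ext hy rfl⟩
        rw [this]
        exact SSet.anodyneExtensions_unionProd_ι' _ _
          (hi.imageStructure d).anodyneExtensions_latching_ι)
    have hΦ' (d k) (x : ((collageNerve.{u} i).obj d ⊗ L).obj k) (w)
        (h : Prescribed (overNerveToCollage i) K t b d k x w) :
        tensorApply Φ x.1 x.2 = w := by
      have hx : x ∈ (F.Q d).obj k := by
        rw [hQ]
        refine mem_unionProd.2 ?_
        obtain ⟨h, -⟩ | ⟨y, hy, -⟩ := h
        · exact Or.inl h
        · exact Or.inr ⟨y, hy⟩
      refine Prescribed.unique Collage.overNerveToCollage_app_injective sq ?_ h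
      have : tensorApply Φ x.1 x.2 = (F.φ d).app k ⟨x, hx⟩ :=
        ConcreteCategory.congr_hom (NatTrans.congr_app (hΦ d) k) ⟨x, hx⟩
      rw [this]
      exact hF d k x hx
    refine ⟨⟨⟨mapSpaceCurry Φ, ?_, ?_⟩⟩⟩
    · refine mapSpace_hom_ext fun d k a l ↦ ?_
      rw [mapSpaceApply_comp, mapSpaceApply_curry]
      exact hΦ' d k (a, l.1) _ (Or.inl ⟨l.2, rfl⟩)
    · refine mapSpace_hom_ext fun d k a l ↦ ?_
      rw [mapSpaceApply_pre, mapSpaceApply_curry]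
      exact hΦ' d k (_, l) _ (Or.inr ⟨a, rfl, rfl⟩)

theorem isWeakEquivalence_mapSpacePre_zerothVertex (hi : IsInitialSegment i)
    {Z : SimplexCategory ⥤ SSet.{u}} (hZ : IsFibrantCosimplicial Z) :
    IsWeakEquivalence (mapSpacePre (zerothVertex i) (i ⋙ Z)) := by
  rw [← overNerveToCollage_comp]
  refine (isWeakEquivalence_mapSpacePre_collageToStdSimplex i (i ⋙ Z)).comp
    (g := mapSpacePre (overNerveToCollage i) (i ⋙ Z)) (isWeakEquivalence_of_rlp _ ?_)
  rw [SSet.rlp_monomorphisms]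
  rintro _ _ _ ⟨n⟩
  exact hasLiftingProperty_mapSpacePre hi hZ _

end

/-! ### The restriction to the truncated simplex category -/

lemma isInitialSegment_id : IsInitialSegment (𝟭 SimplexCategory) where
  full := inferInstance
  faithful := inferInstance
  ext h := SimplexCategory.ext h
  exists_iso _ p _ := ⟨p, ⟨Iso.refl _⟩⟩

lemma isInitialSegment_inclusion (n : ℕ) :
    IsInitialSegment (SimplexCategory.Truncated.inclusion n) where
  full := inferInstance
  faithful := inferInstance
  ext h := ObjectProperty.FullSubcategory.ext (SimplexCategory.ext h)
  exists_iso d p hp := ⟨⟨p, hp.trans d.property⟩, ⟨Iso.refl _⟩⟩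

lemma exists_len_le_of_mem_skeleton {q m : SimplexCategory} {n : ℕ} (f : m ⟶ q)
    (h : SSet.stdSimplex.objEquiv.symm f ∈
      ((SSet.stdSimplex.{u}.obj q).skeleton (n + 1)).obj (op m)) :
    ∃ (r : SimplexCategory) (e : m ⟶ r) (ν : r ⟶ q), r.len ≤ n ∧ Epi e ∧ Mono ν ∧ e ≫ ν = f := by
  obtain ⟨i, hi, g, x, rfl⟩ : ∃ (i : ℕ) (_ : i < n + 1) (g : m ⟶ ⦋i⦌) (x : ⦋i⦌ ⟶ q), g ≫ x = f := by
    have h' : SSet.stdSimplex.objEquiv.symm f ∈ (⨆ (i : Fin (n + 1))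
      (x : (SSet.stdSimplex.{u}.obj q).nonDegenerate i),
        SSet.Subcomplex.ofSimplex x.1).obj (op m) := h
    simp only [Subfunctor.iSup_obj, Set.mem_iUnion] at h'
    obtain ⟨i, x, hx⟩ := h'
    obtain ⟨g, hg⟩ := (SSet.Subcomplex.mem_ofSimplex_obj_iff _ _).1 hx
    exact ⟨i, i.isLt, g, SSet.stdSimplex.objEquiv x.1,
      SSet.stdSimplex.objEquiv.symm.injective hg⟩
  have h₁ := Limits.image.fac x
  have h₂ := Limits.image.fac (g ≫ Limits.factorThruImage x)
  -- Factoring in two stages bounds the length: this image embeds into the image of `x`, which is a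
  -- quotient of `⦋i⦌` with `i ≤ n`.
  refine ⟨Limits.image (g ≫ Limits.factorThruImage x),
    Limits.factorThruImage (g ≫ Limits.factorThruImage x),
    Limits.image.ι (g ≫ Limits.factorThruImage x) ≫ Limits.image.ι x, ?_, inferInstance,
    mono_comp _ _, by rw [reassoc_of% h₂, h₁]⟩
  have h₃ := SimplexCategory.len_le_of_mono (Limits.image.ι (g ≫ Limits.factorThruImage x))
  have h₄ := SimplexCategory.len_le_of_epi (Limits.factorThruImage x)
  change _ ≤ i at h₄
  omega

/-- Take the epi-mono factorization of the simplex. The epi is split, so it lifts against any mono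
`μ`, which gives the comparison `g`. -/
lemma exists_minimal_skDelta {n : ℕ} {q : SimplexCategory} {m : SimplexCategoryᵒᵖ}
    (a : ((skDelta.{u} n).obj q).obj m) :
    ∃ (r : SimplexCategory.Truncated n) (ν : r.obj ⟶ q) (b : ((skDelta.{u} n).obj r.obj).obj m),
      Mono ν ∧ ((skDelta.{u} n).map ν).app m b = a ∧
        ∀ (p : SimplexCategory.Truncated n) (μ : p.obj ⟶ q)
          (c : ((skDelta.{u} n).obj p.obj).obj m), Mono μ → ((skDelta.{u} n).map μ).app m c = a →
          ∃ g : r ⟶ p, g.hom ≫ μ = ν ∧ ((skDelta.{u} n).map g.hom).app m b = c := by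
  obtain ⟨a, ha⟩ := a
  obtain ⟨f, rfl⟩ := SSet.stdSimplex.objEquiv.symm.surjective a
  obtain ⟨r, e, ν, hr, he, hν, rfl⟩ := exists_len_le_of_mem_skeleton f ha
  refine ⟨⟨r, hr⟩, ν, ⟨SSet.stdSimplex.objEquiv.symm e,
    mem_skeleton_stdSimplex (Nat.lt_succ_of_le hr) _⟩, hν, rfl, fun p μ c hμ hc ↦ ?_⟩
  obtain ⟨c, hc'⟩ := c
  obtain ⟨c, rfl⟩ := SSet.stdSimplex.objEquiv.symm.surjective c
  have := isSplitEpi_of_epi e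
  have sq : CommSq c e μ ν :=
    ⟨SSet.stdSimplex.objEquiv.symm.injective (congrArg Subtype.val hc)⟩
  exact ⟨ObjectProperty.homMk sq.lift, sq.fac_right,
    Subtype.ext (congrArg SSet.stdSimplex.objEquiv.symm sq.fac_left)⟩

/-! ### `sk_n Δ` as the left Kan extension of its restriction to `Δ^{<n+1}` -/

section

variable {n : ℕ} {Z : SimplexCategory ⥤ SSet.{u}} {L : SSet.{u}}

open SimplexCategory.Truncated (inclusion)

/-- The values of the extension of a natural transformation from `Δ^{<n+1}` to `Δ`. -/
def IsExtensionValue (φ : (inclusion n ⋙ skDelta.{u} n) ⋙ tensorRight L ⟶ inclusion n ⋙ Z)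
    {q : SimplexCategory} {m : SimplexCategoryᵒᵖ} (a : ((skDelta.{u} n).obj q).obj m)
    (l : L.obj m) (w : (Z.obj q).obj m) : Prop :=
  ∃ (p : SimplexCategory.Truncated n) (μ : p.obj ⟶ q) (_ : Mono μ)
    (b : ((skDelta.{u} n).obj p.obj).obj m), ((skDelta.{u} n).map μ).app m b = a ∧
      w = (Z.map μ).app m (tensorApply φ (d := p) b l)

variable {φ : (inclusion n ⋙ skDelta.{u} n) ⋙ tensorRight L ⟶ inclusion n ⋙ Z}
  {q : SimplexCategory} {m : SimplexCategoryᵒᵖ} {a : ((skDelta.{u} n).obj q).obj m}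
  {l : L.obj m} {w w' : (Z.obj q).obj m}

lemma IsExtensionValue.unique (h : IsExtensionValue φ a l w) (h' : IsExtensionValue φ a l w') :
    w = w' := by
  obtain ⟨r, ν, b, hν, hb, hr⟩ := exists_minimal_skDelta a
  have key {w} (h : IsExtensionValue φ a l w) :
      w = (Z.map ν).app m (tensorApply φ (d := r) b l) := by
    obtain ⟨p, μ, hμ, c, hc, rfl⟩ := h
    obtain ⟨g, rfl, rfl⟩ := hr p μ c hμ hc
    rw [map_comp_app_apply]
    exact congrArg ((Z.map μ).app m) (map_app_tensorApply φ g b l).symm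
  rw [key h, key h']

lemma exists_isExtensionValue (φ : (inclusion n ⋙ skDelta.{u} n) ⋙ tensorRight L ⟶ inclusion n ⋙ Z)
    (a : ((skDelta.{u} n).obj q).obj m) (l : L.obj m) : ∃ w, IsExtensionValue φ a l w := by
  obtain ⟨r, ν, b, hν, hb, -⟩ := exists_minimal_skDelta a
  exact ⟨_, r, ν, hν, b, hb, rfl⟩

lemma IsExtensionValue.map {m' : SimplexCategoryᵒᵖ} (θ : m ⟶ m') (h : IsExtensionValue φ a l w) :
    IsExtensionValue φ (((skDelta.{u} n).obj q).map θ a) (L.map θ l) ((Z.obj q).map θ w) := by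
  obtain ⟨p, μ, hμ, b, rfl, rfl⟩ := h
  refine ⟨p, μ, hμ, ((skDelta.{u} n).obj p.obj).map θ b, NatTrans.naturality_apply _ _ _, ?_⟩
  rw [← NatTrans.naturality_apply]
  exact congrArg ((Z.map μ).app m') (map_tensorApply φ θ b l)

/-- The composite `μ ≫ f` need not be mono; its image is a quotient of `p`, so it still lies in
`Δ^{<n+1}`. -/
lemma IsExtensionValue.map_app {q' : SimplexCategory} (f : q ⟶ q')
    (h : IsExtensionValue φ a l w) :
    IsExtensionValue φ (((skDelta.{u} n).map f).app m a) l ((Z.map f).app m w) := by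
  obtain ⟨p, μ, hμ, b, rfl, rfl⟩ := h
  have hp := (SimplexCategory.len_le_of_epi (Limits.factorThruImage (μ ≫ f))).trans p.property
  let g : p ⟶ ⟨Limits.image (μ ≫ f), hp⟩ :=
    ObjectProperty.homMk (Limits.factorThruImage (μ ≫ f))
  refine ⟨_, Limits.image.ι (μ ≫ f), inferInstance, ((skDelta.{u} n).map g.hom).app m b, ?_, ?_⟩
  · rw [← map_comp_app_apply, ← map_comp_app_apply]
    exact congrArg (fun t ↦ ((skDelta.{u} n).map t).app m b) (Limits.image.fac (μ ≫ f))
  · have h := congrArg (fun t ↦ (Z.map t).app m (tensorApply φ (d := p) b l))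
      (Limits.image.fac (μ ≫ f))
    refine ((map_comp_app_apply Z μ f m _).symm.trans h.symm).trans ?_
    rw [map_comp_app_apply]
    exact congrArg ((Z.map (Limits.image.ι (μ ≫ f))).app m) (map_app_tensorApply φ g b l)

/-- Each simplex of `sk_n Δ[q]` comes along a mono from an object of `Δ^{<n+1}`, so a transformation
is determined by its restriction; the smallest such origin makes the extension well defined. -/
lemma isIso_mapSpaceRestrict (n : ℕ) (Z : SimplexCategory ⥤ SSet.{u}) :
    IsIso (mapSpaceRestrict (inclusion n) (skDelta.{u} n) Z) := by
  rw [NatTrans.isIso_iff_isIso_app]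
  intro k
  rw [isIso_iff_bijective]
  constructor
  · intro φ φ' h
    refine tensorHom_ext (A := skDelta n) fun q m a l ↦ ?_
    obtain ⟨r, ν, b, hν, rfl, -⟩ := exists_minimal_skDelta a
    refine (map_app_tensorApply (A := skDelta n) φ ν b l).symm.trans
      (Eq.trans ?_ (map_app_tensorApply (A := skDelta n) φ' ν b l))
    exact congrArg (fun ψ ↦ (Z.map ν).app m
      (tensorApply (A := inclusion n ⋙ skDelta n) (B := inclusion n ⋙ Z) (d := r) ψ b l)) h
  · intro φ
    choose w hw using fun (q : SimplexCategory) (m : SimplexCategoryᵒᵖ)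
      (a : ((skDelta.{u} n).obj q).obj m) (l : (SSet.stdSimplex.{u}.obj k.unop).obj m) ↦
        exists_isExtensionValue (Z := Z) φ a l
    refine ⟨tensorHomMk w (fun d m m' θ a l ↦ ?_) (fun d d' f m a l ↦ ?_), ?_⟩
    · exact ((hw _ _ _ _).map θ).unique (hw _ _ _ _)
    · exact ((hw _ _ _ _).map_app f).unique (hw _ _ _ _)
    · refine tensorHom_ext (A := inclusion n ⋙ skDelta n) (B := inclusion n ⋙ Z)
        fun q m a l ↦ ?_
      refine (hw q.obj m a l).unique ⟨q, 𝟙 _, inferInstance, a, ?_, ?_⟩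
      · rw [(skDelta n).map_id]
        rfl
      · rw [Z.map_id]
        rfl

end

lemma isIso_whiskerLeft_skDeltaι (n : ℕ) :
    IsIso (Functor.whiskerLeft (SimplexCategory.Truncated.inclusion n) (skDeltaι.{u} n)) := by
  rw [NatTrans.isIso_iff_isIso_app]
  intro q
  rw [NatTrans.isIso_iff_isIso_app]
  intro k
  rw [isIso_iff_bijective]
  exact ⟨Subtype.val_injective, fun x ↦
    ⟨⟨x, mem_skeleton_stdSimplex (Nat.lt_succ_of_le q.property) x⟩, rfl⟩⟩

lemma isIso_mapSpacePre {D : Type} [SmallCategory D] {A A' : D ⥤ SSet.{u}} (w : A' ⟶ A) [IsIso w]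
    (B : D ⥤ SSet.{u}) : IsIso (mapSpacePre w B) := by
  have h₁ : mapSpacePre w B ≫ mapSpacePre (inv w) B = mapSpacePre (inv w ≫ w) B := rfl
  have h₂ : mapSpacePre (inv w) B ≫ mapSpacePre w B = mapSpacePre (w ≫ inv w) B := rfl
  rw [IsIso.inv_hom_id] at h₁
  rw [IsIso.hom_inv_id] at h₂
  exact ⟨mapSpacePre (inv w) B, h₁, h₂⟩

lemma isWeakEquivalence_mapSpacePre_zerothVertexN {Z : SimplexCategory ⥤ SSet.{u}}
    (hZ : IsFibrantCosimplicial Z) (n : ℕ) :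
    IsWeakEquivalence (mapSpacePre (zerothVertexN n)
      (SimplexCategory.Truncated.inclusion n ⋙ Z)) := by
  have := isIso_whiskerLeft_skDeltaι.{u} n
  let w := Functor.whiskerLeft (SimplexCategory.Truncated.inclusion n) (skDeltaι.{u} n)
  have hw : zerothVertexN n = zerothVertex (SimplexCategory.Truncated.inclusion n) ≫ inv w := by
    rw [IsIso.eq_comp_inv]
    rfl
  have := isIso_mapSpacePre (inv w) (SimplexCategory.Truncated.inclusion n ⋙ Z)
  have h : mapSpacePre (zerothVertexN n) (SimplexCategory.Truncated.inclusion n ⋙ Z) =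
      mapSpacePre (inv w) _ ≫ mapSpacePre (zerothVertex _) _ := by
    rw [hw]
    rfl
  rw [h]
  exact (isWeakEquivalence_of_isIso (mapSpacePre (inv w) _)).comp
    (isWeakEquivalence_mapSpacePre_zerothVertex (isInitialSegment_inclusion n) hZ)

theorem isWeakEquivalence_totNToHolimN {Z : SimplexCategory ⥤ SSet.{u}}
    (hZ : IsFibrantCosimplicial Z) (n : ℕ) : IsWeakEquivalence (totNToHolimN n Z) :=
  have := isIso_mapSpaceRestrict n Z
  (isWeakEquivalence_of_isIso (mapSpaceRestrict (SimplexCategory.Truncated.inclusion n)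
    (skDelta n) Z)).comp (isWeakEquivalence_mapSpacePre_zerothVertexN hZ n)

end CosimplicialSpace

end

open CosimplicialSpace in
theorem mainTheorem8 :
    -- `z^*` is a weak equivalence, for `n = ∞` and for all finite `n`
    (∀ Z : SimplexCategory ⥤ SSet.{u}, IsFibrantCosimplicial Z →
      IsWeakEquivalence (totToHolim Z) ∧ ∀ n : ℕ, IsWeakEquivalence (totNToHolimN n Z)) ∧
    -- naturality of `z^*` in the cosimplicial space
    (∀ (Z W : SimplexCategory ⥤ SSet.{u}) (f : Z ⟶ W),
      totMap f ≫ totToHolim W = totToHolim Z ≫ holimMap f ∧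
      ∀ n : ℕ, totNMap n f ≫ totNToHolimN n W = totNToHolimN n Z ≫ holimNMap n f) ∧
    -- compatibility for varying `0 ≤ n ≤ m ≤ ∞`
    (∀ Z : SimplexCategory ⥤ SSet.{u},
      (∀ (n m : ℕ) (h : n ≤ m),
        totNRestrict h Z ≫ totNToHolimN n Z = totNToHolimN m Z ≫ holimNRestrict h Z) ∧
      ∀ n : ℕ, totRestrict n Z ≫ totNToHolimN n Z = totToHolim Z ≫ holimNOfHolim n Z) := by
  -- Naturality and the compatibilities hold by `rfl`: both sides compose with the same maps, vertex
  -- by vertex.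
  refine ⟨fun Z hZ ↦ ⟨isWeakEquivalence_mapSpacePre_zerothVertex isInitialSegment_id hZ,
    isWeakEquivalence_totNToHolimN hZ⟩, fun Z W f ↦ ⟨rfl, fun n ↦ rfl⟩, fun Z ↦ ⟨?_, ?_⟩⟩
  · intro n m h
    rfl
  · intro n
    rfl
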